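/- **Setting.** A *component type* $\mathcal C^k=\langle \mathsf P^k,\mathsf S^k,s_0^k,\Delta^k\rangle$, $k\in[1,n]$, has finite sets of ports and of states, an initial state and transitions $s\xrightarrow{p}s'$, at most one for each port $p$; write ${}^\bullet p=s$, $p^\bullet=s'$ (and ${}^\bullet p=p^\bullet=\bot$ if $p$ has no transition). *Monadic interaction logic* (MIL) has formulae built from equalities $i=j$ of index variables, atoms $\mathrm{pred}(i)$, where $\mathrm{pred}$ is a port or state of type $k$ and $i$ a variable of type $k$, boolean connectives and quantifiers. For instance counts $\mathsf M:[1,n]\to\mathbb N$, a structure interprets each predicate symbol by a subset of $\mathfrak U=[1,\max_k\mathsf M(k)]$, and quantified variables of type $k$ range over $[1,\mathsf M(k)]$. Structures with the same $\mathsf M$ are ordered by pointwise inclusion of the interpretations; $\phi\equiv^\mu\psi$ means that $\phi$ and $\psi$ have the same minimal models, for every $\mathsf M$. A formula is *positive* if every predicate symbol occurs under an even number of negations. The dual $\mathrm{dual}(\phi)$ exchanges $\wedge$ and $\vee$, $\exists$ and $\forall$, $i=j$ and $\neg\, i=j$, and keeps the atoms $\mathrm{pred}(i)$. The *interaction formula*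 $\Gamma$ is a finite disjunction of formulae $$\exists i_1\ldots\exists i_\ell\,.\ \varphi\wedge\bigwedge_{j=1}^{\ell}p_j(i_j)\wedge\bigwedge_{j=\ell+1}^{\ell+m}\forall i_j\,.\ \psi_j\to p_j(i_j),$$ where $p_j$ are ports and $\varphi$, $\psi_j$ are conjunctions of equalities and disequalities between $i_1,\dots,i_\ell$, respectively $i_1,\dots,i_\ell,i_j$. The system $\mathcal S=\langle\mathcal C^1,\dots,\mathcal C^n,\mathsf M,\Gamma\rangle$ executes as the marked Petri net $\mathcal N_{\mathcal S}$ with places $(s,i)$, $s\in\mathsf S^k$, $i\in[1,\mathsf M(k)]$, initially one token on each $(s_0^k,i)$ and none elsewhere, and one transition for each minimal model of $\Gamma$, which has an edge from $(s,i)$ and an edge to $(s',i)$ whenever $s\xrightarrow{p}s'$ and $i$ is in the interpretation of $p$. The system is *deadlock-free* if every reachable marking of $\mathcal N_{\mathcal S}$ enables some transition. Put $\mathrm{Init}(\mathcal S)=\bigvee_k\exists i\,.\,s_0^k(i)$, let $\Theta(\Gamma)$ be the conjunction, over the disjuncts of $\Gamma$, of $$\forall i_1\ldots\forall i_\ell\,.\Big[\varphi\wedge\Big(\bigvee_{j\le\ell}{}^\bullet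 p_j(i_j)\vee\bigvee_{j>\ell}\exists i_j.\,\psi_j\wedge{}^\bullet p_j(i_j)\Big)\Big]\to\Big[\bigvee_{j\le\ell}p_j^\bullet(i_j)\vee\bigvee_{j>\ell}\exists i_j.\,\psi_j\wedge p_j^\bullet(i_j)\Big],$$ and let $\Delta(\Gamma)$ be the conjunction, over the disjuncts of $\Gamma$, of $$\forall i_1\ldots\forall i_\ell\,.\ \varphi\to\Big[\bigvee_{j\le\ell}\neg{}^\bullet p_j(i_j)\vee\bigvee_{j>\ell}\exists i_j.\,\psi_j\wedge\neg{}^\bullet p_j(i_j)\Big],$$ which describes the configurations in which every interaction is disabled. The operator $\mathrm{ppos}$ maps a MIL sentence, written as a finite disjunction of conjunctions $C=\bigwedge_c(\ell_c\le|c|\le u_c)$ of cardinality constraints on the complete minterms $c$ over the predicate symbols, to the disjunction of the formulae $\mathrm{ppos}(C)$, each of which is the conjunction of the constraints $|\tau|\ge\sum_{c^+\to\tau}\ell_c$, for the positive boolean combinations $\tau$ of predicate symbols, and $|\tau|\le\sum_{c^-\to\tau}u_c$, for the positive boolean combinations $\tau$ of negated predicate symbols ($c^+$, $c^-$ being the conjunctions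 of the positive, respectively negative, literals of $c$). **Statement.** The operator $\mathrm{ppos}$ is a positivation operator: for every MIL sentence $\phi$, $\mathrm{ppos}(\phi)$ is a positive sentence and $\phi\equiv^\mu\mathrm{ppos}(\phi)$. For all instance counts $\mathsf M$, the parametric system $\mathcal S=\langle\mathcal C^1,\dots,\mathcal C^n,\mathsf M,\Gamma\rangle$ is deadlock-free if the MIL formula $$\mathrm{dual}\big(\mathrm{ppos}(\Theta(\Gamma)\wedge\mathrm{Init}(\mathcal S))\big)\wedge\Delta(\Gamma)$$ has no model with the instance counts $\mathsf M$; in particular, if it is unsatisfiable for all instance counts in some class, then the system is deadlock-free for all instance counts in the class. The same holds with $\mathrm{ppos}(\Theta(\Gamma)\wedge\mathrm{Init}(\mathcal S))$ replaced by any positive sentence $\chi$ such that $\Theta(\Gamma)\wedge\mathrm{Init}(\mathcal S)\equiv^\mu\chi$. -/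

import Mathlib

/-! ## Monadic interaction logic (MIL)

Component types are indexed by `Fin n`; `Pred k` is the set of monadic predicate symbols of type `k`.
An index variable is a pair `(k, m)`, the `m`-th variable of type `k`. -/

/-- Index variables; `(k, m)` is the `m`-th variable of component type `k`. -/
abbrev Var (n : ℕ) : Type := Fin n × ℕ

/-- MIL formulae. The atom `pred p m`, with `p : Pred k`, is `p(i)` for the variable `i = (k, m)`, so
predicates are only applied to variables of their own type. Equalities are unrestricted.
Disjunction and universal quantification are kept as connectives of their own. -/
inductive MIL {n : ℕ} (Pred : Fin n → Type) : Type
  | fls : MIL Pred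
  | eq (i j : Var n) : MIL Pred
  | pred {k : Fin n} (p : Pred k) (m : ℕ) : MIL Pred
  | and (φ ψ : MIL Pred) : MIL Pred
  | or (φ ψ : MIL Pred) : MIL Pred
  | neg (φ : MIL Pred) : MIL Pred
  | ex (i : Var n) (φ : MIL Pred) : MIL Pred
  | all (i : Var n) (φ : MIL Pred) : MIL Pred

/-- The universe of instances `[1, max_k M(k)]`. -/
def Univ {n : ℕ} (M : Fin n → ℕ) : Type := {u : ℕ // 1 ≤ u ∧ ∃ k, u ≤ M k}

/-- Interpretations of the predicate symbols as subsets of the universe, ordered by pointwise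
inclusion. -/
abbrev Interp {n : ℕ} (Pred : Fin n → Type) (M : Fin n → ℕ) : Type :=
  ∀ k, Pred k → Set (Univ M)

namespace MIL

variable {n : ℕ} {Pred : Fin n → Type}

def tru : MIL Pred := neg fls

def imp (φ ψ : MIL Pred) : MIL Pred := or (neg φ) ψ

/-- Finite conjunction; the empty one is true. -/
def bigAnd (l : List (MIL Pred)) : MIL Pred := l.foldr and tru

/-- Finite disjunction; the empty one is false. -/
def bigOr (l : List (MIL Pred)) : MIL Pred := l.foldr or fls

/-- `∃ i₁ … ∃ iₗ . φ` -/
def exs (l : List (Var n)) (φ : MIL Pred) : MIL Pred := l.foldr ex φ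

/-- `∀ i₁ … ∀ iₗ . φ` -/
def alls (l : List (Var n)) (φ : MIL Pred) : MIL Pred := l.foldr all φ

/-- Pairwise disequality of the listed variables. -/
def distinct : List (Var n) → MIL Pred
  | [] => tru
  | v :: l => and (bigAnd (l.map fun w => neg (eq v w))) (distinct l)

/-- The free variables of a formula. -/
def freeVars : MIL Pred → Set (Var n)
  | fls => ∅
  | eq i j => {i, j}
  | @pred _ _ k _ m => {(k, m)}
  | and φ ψ => freeVars φ ∪ freeVars ψ
  | or φ ψ => freeVars φ ∪ freeVars ψ
  | neg φ => freeVars φ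
  | ex i φ => freeVars φ \ {i}
  | all i φ => freeVars φ \ {i}

/-- A sentence has no free variables. -/
def IsSentence (φ : MIL Pred) : Prop := freeVars φ = ∅

/-- With `b = true` (`b = false`): each predicate symbol occurs in the formula under an even (odd)
number of negations. -/
def Polarity : Bool → MIL Pred → Prop
  | _, fls => True
  | _, eq _ _ => True
  | b, pred _ _ => b = true
  | b, and φ ψ => Polarity b φ ∧ Polarity b ψ
  | b, or φ ψ => Polarity b φ ∧ Polarity b ψ
  | b, neg φ => Polarity (!b) φ
  | b, ex _ φ => Polarity b φ
  | b, all _ φ => Polarity b φ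

/-- Positive formulae: each predicate symbol occurs under an even number of negations. -/
def IsPositive (φ : MIL Pred) : Prop := Polarity true φ

/-- Satisfaction, for instance counts `M`. A quantified variable of type `k` ranges over `[1, M(k)]`.
The valuation is allowed to take arbitrary values: only sentences are ever interpreted, and in this
way they keep a truth value when the universe is empty. -/
def Sat {M : Fin n → ℕ} (I : Interp Pred M) : (Var n → ℕ) → MIL Pred → Prop
  | _, fls => False
  | ν, eq i j => ν i = ν j
  | ν, @pred _ _ k p m => ∃ u ∈ I k p, u.1 = ν (k, m)
  | ν, and φ ψ => Sat I ν φ ∧ Sat I ν ψ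
  | ν, or φ ψ => Sat I ν φ ∨ Sat I ν ψ
  | ν, neg φ => ¬ Sat I ν φ
  | ν, ex i φ => ∃ a, 1 ≤ a ∧ a ≤ M i.1 ∧ Sat I (Function.update ν i a) φ
  | ν, all i φ => ∀ a, 1 ≤ a → a ≤ M i.1 → Sat I (Function.update ν i a) φ

/-- `I` is a model of the sentence `φ`. -/
def IsModel {M : Fin n → ℕ} (I : Interp Pred M) (φ : MIL Pred) : Prop := ∀ ν, Sat I ν φ

/-- `I` is a minimal model of the sentence `φ`. -/
def IsMinModel {M : Fin n → ℕ} (I : Interp Pred M) (φ : MIL Pred) : Prop :=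
  Minimal (fun J : Interp Pred M => IsModel J φ) I

/-- `φ` and `ψ` have the same minimal models, for all instance counts. -/
def MinEquiv (φ ψ : MIL Pred) : Prop :=
  ∀ (M : Fin n → ℕ) (I : Interp Pred M), IsMinModel I φ ↔ IsMinModel I ψ

/-- The sentence `φ` has a model with instance counts `M`. -/
def SatisfiableAt (M : Fin n → ℕ) (φ : MIL Pred) : Prop := ∃ I : Interp Pred M, IsModel I φ

/-- Dualisation. The clause for negation extends `dual (¬ i = j) ≡ (i = j)` to all formulae. -/
def dual : MIL Pred → MIL Pred
  | fls => tru
  | eq i j => neg (eq i j)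
  | pred p m => pred p m
  | and φ ψ => or (dual φ) (dual ψ)
  | or φ ψ => and (dual φ) (dual ψ)
  | neg φ => neg (dual φ)
  | ex i φ => all i (dual φ)
  | all i φ => ex i (dual φ)

/-! ### Cardinality constraints and positivation -/

/-- `χ` is a positivation of the sentence `φ`: a positive sentence with the same minimal models. -/
def IsPositivation (φ χ : MIL Pred) : Prop := IsSentence χ ∧ IsPositive χ ∧ MinEquiv φ χ

/-- `v ∈ [1, M(k)]`, for a variable `v` of any type. -/
def inRange (k : Fin n) (v : Var n) : MIL Pred := ex (k, v.2 + 1) (eq (k, v.2 + 1) v)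

/-- `p(v)`, for a variable `v` of any type: the instance of the type of `p` that has the number
denoted by `v` exists and satisfies `p`. -/
def holds {k : Fin n} (p : Pred k) (v : Var n) : MIL Pred :=
  ex (k, v.2 + 1) (and (eq (k, v.2 + 1) v) (pred p (v.2 + 1)))

/-- Complete minterms. The cell `(A, T)` stands for the elements `u` of the universe that lie in the
range `[1, M(k)]` exactly for `k ∈ A`, and satisfy exactly the predicates in `T` among those whose
type has `u` in its range. The ranges are not interpreted by the structure, whence the first
component is rigid. -/
abbrev Cell (Pred : Fin n → Type) : Type := Finset (Fin n) × Finset (Σ k, Pred k)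

open Classical in
/-- `v` lies exactly in the ranges `[1, M(k)]` with `k ∈ A`. -/
noncomputable def rangesAre (A : Finset (Fin n)) (v : Var n) : MIL Pred :=
  bigAnd ((List.finRange n).map fun k => if k ∈ A then inRange k v else neg (inRange k v))

/-- The positive part of the minterm `c`, at `v`. -/
noncomputable def cellPos (c : Cell Pred) (v : Var n) : MIL Pred :=
  and (rangesAre c.1 v) (bigAnd (c.2.toList.map fun p => holds p.2 v))

open Classical in
/-- The negation of the negative part of the minterm `c`, at `v`. -/
noncomputable def cellNegCompl [∀ k, Fintype (Pred k)] (c : Cell Pred) (v : Var n) : MIL Pred :=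
  or (neg (rangesAre c.1 v)) (bigOr ((c.2)ᶜ.toList.map fun p => holds p.2 v))

/-- `existsU N vs body` says: there are `N` elements of the universe `[1, max_k M(k)]`, named by new
variables put in front of `vs`, for which `body` holds. As the universe is the union of the ranges
`[1, M(k)]`, a quantifier over it is a disjunction over the types. -/
def existsU : ℕ → List (Var n) → (List (Var n) → MIL Pred) → MIL Pred
  | 0, vs, body => body vs
  | N + 1, vs, body =>
      bigOr ((List.finRange n).map fun k => ex (k, N) (existsU N ((k, N) :: vs) body))

/-- The same as `existsU`, for universal quantification. -/
def forallU : ℕ → List (Var n) → (List (Var n) → MIL Pred) → MIL Pred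
  | 0, vs, body => body vs
  | N + 1, vs, body =>
      bigAnd ((List.finRange n).map fun k => all (k, N) (forallU N ((k, N) :: vs) body))

/-- `|t| ≥ N`, i.e. `∃ i₁ … i_N . distinct(i₁, …, i_N) ∧ ⋀ t(iⱼ)`. -/
def atLeast (N : ℕ) (t : Var n → MIL Pred) : MIL Pred :=
  existsU N [] fun vs => and (distinct vs) (bigAnd (vs.map t))

/-- `|t| ≤ N`, given `tc = ¬ t`, i.e.
`∀ i₁ … i_{N+1} . distinct(i₁, …, i_{N+1}) → ⋁ ¬ t(iⱼ)`. -/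
def atMostCompl (N : ℕ) (tc : Var n → MIL Pred) : MIL Pred :=
  forallU (N + 1) [] fun vs => imp (distinct vs) (bigOr (vs.map tc))

/-- Sets of cells closed under adding (non-rigid) predicates; these are, up to equivalence, the
positive boolean combinations of predicate symbols. -/
def UpClosed (X : Finset (Cell Pred)) : Prop :=
  ∀ c ∈ X, ∀ d : Cell Pred, c.1 = d.1 → c.2 ⊆ d.2 → d ∈ X

/-- Sets of cells closed under removing (non-rigid) predicates; these are, up to equivalence, the
positive boolean combinations of negated predicate symbols. -/
def DownClosed (X : Finset (Cell Pred)) : Prop :=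
  ∀ c ∈ X, ∀ d : Cell Pred, c.1 = d.1 → d.2 ⊆ c.2 → d ∈ X

open Classical in
/-- `|⋁_{c ∈ X} c⁻| ≤ b`, which is true for `b = ∞`. -/
noncomputable def atMostCells [∀ k, Fintype (Pred k)] (X : Finset (Cell Pred)) (b : ℕ∞) :
    MIL Pred :=
  if b = ⊤ then tru
  else atMostCompl b.toNat fun v => bigAnd (X.toList.map fun c => cellNegCompl c v)

open Classical in
/-- The positivation of the conjunction `⋀_c (lo c ≤ |c| ∧ |c| ≤ hi c)` over all complete minterms:
the conjunction of `|τ| ≥ ∑_{c⁺ → τ} lo c`, for all positive combinations `τ` of predicate symbols,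
and of `|τ| ≤ ∑_{c⁻ → τ} hi c`, for all positive combinations `τ` of negated predicate symbols. -/
noncomputable def pposConj [∀ k, Fintype (Pred k)] (lo : Cell Pred → ℕ) (hi : Cell Pred → ℕ∞) :
    MIL Pred :=
  and
    (bigAnd ((Finset.univ.filter fun X : Finset (Cell Pred) => UpClosed X).toList.map fun X =>
      atLeast (∑ c ∈ X, lo c) fun v => bigOr (X.toList.map fun c => cellPos c v)))
    (bigAnd ((Finset.univ.filter fun X : Finset (Cell Pred) => DownClosed X).toList.map fun X =>
      atMostCells X (∑ c ∈ X, hi c)))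

/-- Quantifier rank. -/
def rank : MIL Pred → ℕ
  | fls => 0
  | eq _ _ => 0
  | pred _ _ => 0
  | and φ ψ => max (rank φ) (rank ψ)
  | or φ ψ => max (rank φ) (rank ψ)
  | neg φ => rank φ
  | ex _ φ => rank φ + 1
  | all _ φ => rank φ + 1

/-- The element `u` of the universe belongs to the cell `c` in the structure `I`. -/
def InCell {M : Fin n → ℕ} (I : Interp Pred M) (u : Univ M) (c : Cell Pred) : Prop :=
  (∀ k, k ∈ c.1 ↔ u.1 ≤ M k) ∧ ∀ p : Σ k, Pred k, p ∈ c.2 ↔ (u.1 ≤ M p.1 ∧ u ∈ I p.1 p.2)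

/-- The cardinality of the cell `c` in the structure `I`. -/
noncomputable def cellCard {M : Fin n → ℕ} (I : Interp Pred M) (c : Cell Pred) : ℕ :=
  Set.ncard {u : Univ M | InCell I u c}

open Classical in
/-- A finite set of vectors of cell cardinalities, cut off at the quantifier rank of `φ`, that
represents the disjunctive normal form of `φ` in terms of cardinality constraints on complete
minterms: an entry `a` below the rank stands for `|c| = a`, and the entry `rank φ` for
`|c| ≥ rank φ`. -/
noncomputable def cardDNF [∀ k, Fintype (Pred k)] (φ : MIL Pred) :
    Finset (Cell Pred → Fin (rank φ + 1)) :=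
  Finset.univ.filter fun f =>
    ∃ (M : Fin n → ℕ) (I : Interp Pred M), IsModel I φ ∧
      ∀ c, (f c : ℕ) = min (cellCard I c) (rank φ)

open Classical in
/-- The positivation operator: put the sentence in disjunctive normal form, in terms of cardinality
constraints, and apply `pposConj` to each conjunction. -/
noncomputable def ppos [∀ k, Fintype (Pred k)] (φ : MIL Pred) : MIL Pred :=
  bigOr ((cardDNF φ).toList.map fun f =>
    pposConj (fun c => (f c : ℕ)) (fun c => if (f c : ℕ) < rank φ then ((f c : ℕ) : ℕ∞) else ⊤))

end MIL

/-! ## Marked Petri nets -/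

/-- A Petri net with an initial marking. -/
structure MarkedPetriNet where
  Place : Type
  Trans : Type
  /-- Edges from places to transitions. -/
  input : Place → Trans → Prop
  /-- Edges from transitions to places. -/
  output : Trans → Place → Prop
  initial : Place → ℕ

namespace MarkedPetriNet

variable (N : MarkedPetriNet)

def Enabled (m : N.Place → ℕ) (t : N.Trans) : Prop := ∀ s, N.input s t → 1 ≤ m s

open Classical in
/-- `m'` is the result of firing an enabled transition in `m`. -/
def Step (m m' : N.Place → ℕ) : Prop :=
  ∃ t, N.Enabled m t ∧
    ∀ s, m' s = m s - (if N.input s t then 1 else 0) + (if N.output t s then 1 else 0)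

def Reachable (m : N.Place → ℕ) : Prop := Relation.ReflTransGen N.Step N.initial m

/-- A marking in which no transition is enabled. -/
def IsDeadlock (m : N.Place → ℕ) : Prop := ∀ t, ¬ N.Enabled m t

def DeadlockFree : Prop := ∀ m, N.Reachable m → ¬ N.IsDeadlock m

end MarkedPetriNet

/-! ## Parametric systems -/

/-- A component (type), in which no two different transitions have the same port. -/
structure Component where
  Port : Type
  State : Type
  [fintypePort : Fintype Port]
  [fintypeState : Fintype State]
  initial : State
  trans : State → Port → State → Prop
  trans_unique : ∀ {p s₁ s₁' s₂ s₂'}, trans s₁ p s₁' → trans s₂ p s₂' → s₁ = s₂ ∧ s₁' = s₂'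

attribute [instance] Component.fintypePort Component.fintypeState

namespace Component

/-- The predicate symbols of a component type: its ports and its states. -/
abbrev Sym (C : Component) : Type := C.Port ⊕ C.State

open Classical in
/-- The pre-state of a port, if the port has a transition. -/
noncomputable def pre (C : Component) (p : C.Port) : Option C.State :=
  if h : ∃ s s', C.trans s p s' then some h.choose else none

open Classical in
/-- The post-state of a port, if the port has a transition. -/
noncomputable def post (C : Component) (p : C.Port) : Option C.State :=
  if h : ∃ s' s, C.trans s p s' then some h.choose else none

end Component

/-- An equality or a disequality. -/
inductive EqLit (V : Type) : Type
  | eq (i j : V) : EqLit V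
  | ne (i j : V) : EqLit V

/-- One disjunct of an interaction formula,
`∃ i₁ … ∃ iₗ . φ ∧ ⋀ⱼ pⱼ(iⱼ) ∧ ⋀ⱼ ∀ iₗ₊ⱼ . ψⱼ → pₗ₊ⱼ(iₗ₊ⱼ)`,
where `φ` is a conjunction of equalities and disequalities between `i₁, …, iₗ`, and `ψⱼ` is one
between `i₁, …, iₗ` (written `some _`) and `iₗ₊ⱼ` (written `none`). -/
structure Interaction {n : ℕ} (C : Fin n → Component) where
  rdv : ℕ
  type : Fin rdv → Fin n
  port : ∀ j, (C (type j)).Port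
  guard : List (EqLit (Fin rdv))
  bcast : ℕ
  btype : Fin bcast → Fin n
  bport : ∀ j, (C (btype j)).Port
  bguard : Fin bcast → List (EqLit (Option (Fin rdv)))

namespace Interaction

variable {n : ℕ} {C : Fin n → Component} (γ : Interaction C)

/-- MIL formulae over the ports and states of the component types `C`. -/
abbrev Formula (C : Fin n → Component) : Type := MIL fun k => (C k).Sym

def litFormula {V : Type} (f : V → Var n) : EqLit V → Formula C
  | .eq i j => .eq (f i) (f j)
  | .ne i j => .neg (.eq (f i) (f j))

/-- The variables `i₁, …, iₗ`. -/
def var (j : Fin γ.rdv) : Var n := (γ.type j, j)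

/-- The variables `iₗ₊₁, …, iₗ₊ₘ`. -/
def bvar (j : Fin γ.bcast) : Var n := (γ.btype j, γ.rdv + j)

def vars : List (Var n) := List.ofFn γ.var

def guardFormula : Formula C := .bigAnd (γ.guard.map (litFormula γ.var))

def bguardFormula (j : Fin γ.bcast) : Formula C :=
  .bigAnd ((γ.bguard j).map (litFormula fun o => o.elim (γ.bvar j) γ.var))

/-- `p(i)` for a port `p` of type `k` and the variable `i = (k, m)`. -/
def portAtom {k : Fin n} (p : (C k).Port) (m : ℕ) : Formula C :=
  .pred (k := k) (Sum.inl p) m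

/-- `s(i)` for a state `s` of type `k`, or `⊥` if there is none. -/
def stateAtom {k : Fin n} (s : Option (C k).State) (m : ℕ) : Formula C :=
  s.elim .fls fun s => .pred (k := k) (Sum.inr s) m

/-- The disjunct as a formula. -/
def formula : Formula C :=
  .exs γ.vars <| .and γ.guardFormula <| .and
    (.bigAnd (List.ofFn fun j => portAtom (γ.port j) (γ.var j).2))
    (.bigAnd (List.ofFn fun j =>
      .all (γ.bvar j) (.imp (γ.bguardFormula j) (portAtom (γ.bport j) (γ.bvar j).2))))

/-- `⋁ⱼ •pⱼ(iⱼ) ∨ ⋁ⱼ ∃ iₗ₊ⱼ . ψⱼ ∧ •pₗ₊ⱼ(iₗ₊ⱼ)` -/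
noncomputable def somePre : Formula C :=
  .or (.bigOr (List.ofFn fun j => stateAtom ((C _).pre (γ.port j)) (γ.var j).2))
    (.bigOr (List.ofFn fun j => .ex (γ.bvar j)
      (.and (γ.bguardFormula j) (stateAtom ((C _).pre (γ.bport j)) (γ.bvar j).2))))

/-- `⋁ⱼ pⱼ•(iⱼ) ∨ ⋁ⱼ ∃ iₗ₊ⱼ . ψⱼ ∧ pₗ₊ⱼ•(iₗ₊ⱼ)` -/
noncomputable def somePost : Formula C :=
  .or (.bigOr (List.ofFn fun j => stateAtom ((C _).post (γ.port j)) (γ.var j).2))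
    (.bigOr (List.ofFn fun j => .ex (γ.bvar j)
      (.and (γ.bguardFormula j) (stateAtom ((C _).post (γ.bport j)) (γ.bvar j).2))))

/-- The trap constraint of the disjunct. -/
noncomputable def trapConstraint : Formula C :=
  .alls γ.vars (.imp (.and γ.guardFormula γ.somePre) γ.somePost)

/-- The disjunct is disabled. -/
noncomputable def deadConstraint : Formula C :=
  .alls γ.vars <| .imp γ.guardFormula <| .or
    (.bigOr (List.ofFn fun j => .neg (stateAtom ((C _).pre (γ.port j)) (γ.var j).2)))
    (.bigOr (List.ofFn fun j => .ex (γ.bvar j)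
      (.and (γ.bguardFormula j) (.neg (stateAtom ((C _).pre (γ.bport j)) (γ.bvar j).2)))))

end Interaction

/-- A parametric system with `n` component types; the instance counts are kept apart. The
interaction formula is the disjunction of the listed interactions. -/
structure ParametricSystem (n : ℕ) where
  comp : Fin n → Component
  interactions : List (Interaction comp)

namespace ParametricSystem

variable {n : ℕ} (S : ParametricSystem n)

abbrev Pred (k : Fin n) : Type := (S.comp k).Sym

/-- The interaction formula `Γ`. -/
def Γ : MIL S.Pred := .bigOr (S.interactions.map fun γ => γ.formula)

/-- The trap constraint `Θ(Γ)`. -/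
noncomputable def trapConstraint : MIL S.Pred :=
  .bigAnd (S.interactions.map fun γ => γ.trapConstraint)

/-- `Init(S) = ⋁ₖ ∃ i . s₀ᵏ(i)`. -/
def initFormula : MIL S.Pred :=
  .bigOr ((List.finRange n).map fun k =>
    .ex (k, 0) (.pred (k := k) (Sum.inr (S.comp k).initial) 0))

/-- The deadlock constraint `Δ(Γ)`: all interactions are disabled. -/
noncomputable def deadConstraint : MIL S.Pred :=
  .bigAnd (S.interactions.map fun γ => γ.deadConstraint)

open Classical in
/-- The marked Petri net of the system with instance counts `M`. Its places are the pairs of a state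
of type `k` and an instance in `[1, M(k)]`, its transitions the minimal models of `Γ`. -/
noncomputable def petriNet (M : Fin n → ℕ) : MarkedPetriNet where
  Place := Σ k, (S.comp k).State × {i : ℕ // 1 ≤ i ∧ i ≤ M k}
  Trans := {I : Interp S.Pred M // MIL.IsMinModel I S.Γ}
  input := fun ⟨k, s, i⟩ t =>
    ∃ p s', (S.comp k).trans s p s' ∧ ∃ u ∈ t.1 k (Sum.inl p), u.1 = i.1
  output := fun t ⟨k, s', i⟩ =>
    ∃ p s, (S.comp k).trans s p s' ∧ ∃ u ∈ t.1 k (Sum.inl p), u.1 = i.1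
  initial := fun ⟨k, s, _⟩ => if s = (S.comp k).initial then 1 else 0

end ParametricSystem

/-! The argument combines a normal form, a matching theorem and a trap invariant.

Normal form. A sentence of quantifier rank `r` cannot distinguish two structures whose cells have
the same cardinalities up to `r`: by an Ehrenfeucht–Fraïssé game, the second player answers inside
the same cell (`BackForth.sat_iff`). As cells record the ranges, this works even across different
instance counts, so `cardDNF` does represent the sentence (`IsSentence.isModel_iff_cardDNF`).

Positivation. A conjunction of cardinality constraints implies its positivation, by summing over
cells. Conversely, let `I` satisfy the positivation. A model of the conjunction below `I` amounts to
sending each element to a cell below its own, with fibres between the prescribed bounds. The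
constraints on positive combinations give Hall's condition for the lower bounds, those on negated
ones give it for the upper bounds, and the Mendelsohn–Dulmage theorem merges the two matchings
(`exists_map_card_fiber_between`, `exists_le_of_sat_pposConj`). Thus every model of `φ` is a model
of `ppos φ`, and every model of `ppos φ` lies above one of `φ`; this forces equal minimal models.

Traps. The states in a model of the trap constraint and `Init` form an initially marked trap, which
stays marked in every reachable marking (`TrapMarked.of_reachable`). Suppose a reachable marking is
a deadlock. Its structure satisfies the deadlock constraint. It also satisfies `dual χ`: otherwise
`χ` would hold in the complementary structure, and a minimal model of `χ` below that complement
would be a trap without tokens. So a reachable deadlock yields a model of the formula assumed to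
have none. -/

namespace MIL

variable {n : ℕ} {Pred : Fin n → Type} {M : Fin n → ℕ}

/-! ### Semantics of the derived connectives -/

section Connectives

variable (I : Interp Pred M) (ν : Var n → ℕ)

@[simp] theorem sat_tru : Sat I ν tru := by simp [tru, Sat]

@[simp] theorem sat_imp (φ ψ : MIL Pred) : Sat I ν (imp φ ψ) ↔ (Sat I ν φ → Sat I ν ψ) := by
  simp only [imp, Sat]; tauto

@[simp] theorem sat_bigAnd (l : List (MIL Pred)) :
    Sat I ν (bigAnd l) ↔ ∀ φ ∈ l, Sat I ν φ := by
  induction l with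
  | nil => simp [bigAnd]
  | cons φ l ih => simp only [bigAnd, List.foldr_cons, Sat, List.forall_mem_cons] at ih ⊢; rw [ih]

@[simp] theorem sat_bigOr (l : List (MIL Pred)) :
    Sat I ν (bigOr l) ↔ ∃ φ ∈ l, Sat I ν φ := by
  induction l with
  | nil => simp [bigOr, Sat]
  | cons φ l ih => simp only [bigOr, List.foldr_cons, Sat, List.exists_mem_cons_iff] at ih ⊢; rw [ih]

theorem sat_bigOr_map {α : Type*} (l : List α) (f : α → MIL Pred) :
    Sat I ν (bigOr (l.map f)) ↔ ∃ a ∈ l, Sat I ν (f a) := by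
  rw [sat_bigOr]
  constructor
  · rintro ⟨φ, hφ, h⟩
    obtain ⟨a, ha, rfl⟩ := List.mem_map.1 hφ
    exact ⟨a, ha, h⟩
  · rintro ⟨a, ha, h⟩
    exact ⟨f a, List.mem_map_of_mem ha, h⟩

theorem sat_bigAnd_map {α : Type*} (l : List α) (f : α → MIL Pred) :
    Sat I ν (bigAnd (l.map f)) ↔ ∀ a ∈ l, Sat I ν (f a) := by
  rw [sat_bigAnd, List.forall_mem_map]

theorem sat_distinct (l : List (Var n)) : Sat I ν (distinct l) ↔ (l.map ν).Nodup := by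
  induction l with
  | nil => simp [distinct]
  | cons v l ih =>
    simp only [distinct, Sat, sat_bigAnd, List.forall_mem_map, ih, List.map_cons, List.nodup_cons]
    simp only [List.mem_map, not_exists, not_and]
    exact and_congr_left fun _ => forall₂_congr fun w _ => ne_comm

end Connectives

/-! ### Free variables -/

theorem sat_congr (I : Interp Pred M) (φ : MIL Pred) {ν ν' : Var n → ℕ}
    (h : ∀ v ∈ freeVars φ, ν v = ν' v) : Sat I ν φ ↔ Sat I ν' φ := by
  have upd : ∀ {i : Var n} {s : Set (Var n)} {ν ν' : Var n → ℕ} (a : ℕ),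
      (∀ v ∈ s \ {i}, ν v = ν' v) →
      ∀ v ∈ s, Function.update ν i a v = Function.update ν' i a v := by
    intro i s ν ν' a h v hv
    by_cases hvi : v = i
    · simp [hvi]
    · simpa [hvi] using h v ⟨hv, hvi⟩
  induction φ generalizing ν ν' with
  | fls => rfl
  | eq i j => simp only [Sat, h i (by simp [freeVars]), h j (by simp [freeVars])]
  | pred p m => simp only [Sat, h _ (by simp only [freeVars]; exact rfl)]
  | and φ ψ ihφ ihψ =>
    exact and_congr (ihφ fun v hv => h v (.inl hv)) (ihψ fun v hv => h v (.inr hv))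
  | or φ ψ ihφ ihψ =>
    exact or_congr (ihφ fun v hv => h v (.inl hv)) (ihψ fun v hv => h v (.inr hv))
  | neg φ ih => exact not_congr (ih h)
  | ex i φ ih =>
    exact exists_congr fun a => and_congr_right fun _ => and_congr_right fun _ => ih (upd a h)
  | all i φ ih => exact forall₃_congr fun a _ _ => ih (upd a h)

theorem IsSentence.isModel_iff {φ : MIL Pred} (hφ : φ.IsSentence) (I : Interp Pred M)
    (ν : Var n → ℕ) : IsModel I φ ↔ Sat I ν φ :=
  ⟨fun h => h ν, fun h ν' => (sat_congr I φ (by rw [show freeVars φ = ∅ from hφ]; simp)).1 h⟩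

theorem freeVars_bigAnd_subset {l : List (MIL Pred)} {s : Set (Var n)}
    (h : ∀ φ ∈ l, freeVars φ ⊆ s) : freeVars (bigAnd l) ⊆ s := by
  induction l with
  | nil => simp [bigAnd, tru, freeVars]
  | cons φ l ih =>
    rw [List.forall_mem_cons] at h
    exact Set.union_subset h.1 (ih h.2)

theorem freeVars_bigOr_subset {l : List (MIL Pred)} {s : Set (Var n)}
    (h : ∀ φ ∈ l, freeVars φ ⊆ s) : freeVars (bigOr l) ⊆ s := by
  induction l with
  | nil => simp [bigOr, freeVars]
  | cons φ l ih =>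
    rw [List.forall_mem_cons] at h
    exact Set.union_subset h.1 (ih h.2)

theorem freeVars_distinct_subset (l : List (Var n)) :
    freeVars (distinct l : MIL Pred) ⊆ {v | v ∈ l} := by
  induction l with
  | nil => simp [distinct, tru, freeVars]
  | cons v l ih =>
    refine Set.union_subset (freeVars_bigAnd_subset ?_) fun w hw => List.mem_cons_of_mem _ (ih hw)
    simp only [List.forall_mem_map, freeVars]
    rintro w hw x (rfl | rfl)
    · simp
    · exact List.mem_cons_of_mem _ hw

/-- Each quantifier binds exactly the variable that it puts in front of the list. -/
theorem freeVars_existsU_subset (body : List (Var n) → MIL Pred)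
    (h : ∀ vs, freeVars (body vs) ⊆ {v | v ∈ vs}) (N : ℕ) (vs : List (Var n)) :
    freeVars (existsU N vs body) ⊆ {v | v ∈ vs} := by
  induction N generalizing vs with
  | zero => exact h vs
  | succ N ih =>
    refine freeVars_bigOr_subset ?_
    simp only [List.forall_mem_map, freeVars]
    rintro k - v ⟨hv, hvk⟩
    exact (List.mem_cons.1 (ih _ hv)).resolve_left hvk

theorem freeVars_forallU_subset (body : List (Var n) → MIL Pred)
    (h : ∀ vs, freeVars (body vs) ⊆ {v | v ∈ vs}) (N : ℕ) (vs : List (Var n)) :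
    freeVars (forallU N vs body) ⊆ {v | v ∈ vs} := by
  induction N generalizing vs with
  | zero => exact h vs
  | succ N ih =>
    refine freeVars_bigAnd_subset ?_
    simp only [List.forall_mem_map, freeVars]
    rintro k - v ⟨hv, hvk⟩
    exact (List.mem_cons.1 (ih _ hv)).resolve_left hvk

theorem freeVars_atLeast (N : ℕ) (t : Var n → MIL Pred) (h : ∀ v, freeVars (t v) ⊆ {v}) :
    freeVars (atLeast N t) ⊆ ∅ := by
  refine (freeVars_existsU_subset _ (fun vs => ?_) N []).trans (by simp)
  refine Set.union_subset (freeVars_distinct_subset vs) (freeVars_bigAnd_subset ?_)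
  simp only [List.forall_mem_map]
  exact fun v hv => (h v).trans (by simpa using hv)

theorem freeVars_atMostCompl (N : ℕ) (t : Var n → MIL Pred) (h : ∀ v, freeVars (t v) ⊆ {v}) :
    freeVars (atMostCompl N t) ⊆ ∅ := by
  refine (freeVars_forallU_subset _ (fun vs => ?_) (N + 1) []).trans (by simp)
  refine Set.union_subset (freeVars_distinct_subset vs) (freeVars_bigOr_subset ?_)
  simp only [List.forall_mem_map]
  exact fun v hv => (h v).trans (by simpa using hv)

theorem freeVars_inRange (k : Fin n) (v : Var n) : freeVars (inRange k v : MIL Pred) ⊆ {v} := by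
  rintro w ⟨rfl | rfl, h⟩
  · exact absurd rfl h
  · rfl

theorem freeVars_holds {k : Fin n} (p : Pred k) (v : Var n) : freeVars (holds p v) ⊆ {v} := by
  rintro w ⟨(rfl | rfl) | rfl, h⟩
  · exact absurd rfl h
  · rfl
  · exact absurd rfl h

theorem freeVars_rangesAre (A : Finset (Fin n)) (v : Var n) :
    freeVars (rangesAre A v : MIL Pred) ⊆ {v} := by
  refine freeVars_bigAnd_subset ?_
  simp only [List.forall_mem_map]
  intro k _
  split_ifs <;> exact freeVars_inRange k v

theorem freeVars_cellPos (c : Cell Pred) (v : Var n) : freeVars (cellPos c v) ⊆ {v} := by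
  refine Set.union_subset (freeVars_rangesAre _ v) (freeVars_bigAnd_subset ?_)
  simp only [List.forall_mem_map]
  exact fun p _ => freeVars_holds _ v

theorem freeVars_cellNegCompl [∀ k, Fintype (Pred k)] (c : Cell Pred) (v : Var n) :
    freeVars (cellNegCompl c v) ⊆ {v} := by
  refine Set.union_subset (freeVars_rangesAre c.1 v) (freeVars_bigOr_subset ?_)
  simp only [List.forall_mem_map]
  exact fun p _ => freeVars_holds _ v

theorem freeVars_atMostCells [∀ k, Fintype (Pred k)] (X : Finset (Cell Pred)) (b : ℕ∞) :
    freeVars (atMostCells X b) ⊆ ∅ := by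
  rw [atMostCells]
  split_ifs
  · simp [tru, freeVars]
  · refine freeVars_atMostCompl _ _ fun v => freeVars_bigAnd_subset ?_
    simp only [List.forall_mem_map]
    exact fun c _ => freeVars_cellNegCompl c v

theorem freeVars_pposConj [∀ k, Fintype (Pred k)] (lo : Cell Pred → ℕ) (hi : Cell Pred → ℕ∞) :
    freeVars (pposConj lo hi) ⊆ ∅ := by
  refine Set.union_subset (freeVars_bigAnd_subset ?_) (freeVars_bigAnd_subset ?_) <;>
    simp only [List.forall_mem_map]
  · refine fun X _ => freeVars_atLeast _ _ fun v => freeVars_bigOr_subset ?_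
    simp only [List.forall_mem_map]
    exact fun c _ => freeVars_cellPos c v
  · exact fun X _ => freeVars_atMostCells _ _

theorem isSentence_ppos [∀ k, Fintype (Pred k)] (φ : MIL Pred) : (ppos φ).IsSentence := by
  refine Set.subset_empty_iff.1 (freeVars_bigOr_subset ?_)
  simp only [List.forall_mem_map]
  exact fun f _ => freeVars_pposConj _ _

/-! ### Polarity -/

theorem polarity_bigAnd {b : Bool} {l : List (MIL Pred)} (h : ∀ φ ∈ l, Polarity b φ) :
    Polarity b (bigAnd l) := by
  induction l with
  | nil => trivial
  | cons φ l ih => rw [List.forall_mem_cons] at h; exact ⟨h.1, ih h.2⟩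

theorem polarity_bigOr {b : Bool} {l : List (MIL Pred)} (h : ∀ φ ∈ l, Polarity b φ) :
    Polarity b (bigOr l) := by
  induction l with
  | nil => trivial
  | cons φ l ih => rw [List.forall_mem_cons] at h; exact ⟨h.1, ih h.2⟩

theorem polarity_distinct (b : Bool) (l : List (Var n)) :
    Polarity b (distinct l : MIL Pred) := by
  induction l with
  | nil => trivial
  | cons v l ih => exact ⟨polarity_bigAnd (List.forall_mem_map.2 fun _ _ => trivial), ih⟩

theorem polarity_existsU {b : Bool} {body : List (Var n) → MIL Pred}
    (h : ∀ vs, Polarity b (body vs)) (N : ℕ) (vs : List (Var n)) :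
    Polarity b (existsU N vs body) := by
  induction N generalizing vs with
  | zero => exact h vs
  | succ N ih =>
    refine polarity_bigOr ?_
    simp only [List.forall_mem_map]
    exact fun k _ => ih _

theorem polarity_forallU {b : Bool} {body : List (Var n) → MIL Pred}
    (h : ∀ vs, Polarity b (body vs)) (N : ℕ) (vs : List (Var n)) :
    Polarity b (forallU N vs body) := by
  induction N generalizing vs with
  | zero => exact h vs
  | succ N ih =>
    refine polarity_bigAnd ?_
    simp only [List.forall_mem_map]
    exact fun k _ => ih _

/-- Ranges are expressed by equalities alone, so this formula may occur under any number of
negations. -/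
theorem polarity_rangesAre (b : Bool) (A : Finset (Fin n)) (v : Var n) :
    Polarity b (rangesAre A v : MIL Pred) := by
  refine polarity_bigAnd ?_
  simp only [List.forall_mem_map]
  intro k _
  split_ifs <;> trivial

theorem isPositive_holds {k : Fin n} (p : Pred k) (v : Var n) : (holds p v).IsPositive :=
  ⟨trivial, rfl⟩

theorem polarity_atLeast {b : Bool} {t : Var n → MIL Pred} (h : ∀ v, Polarity b (t v)) (N : ℕ) :
    Polarity b (atLeast N t) := by
  refine polarity_existsU (fun vs => ?_) N []
  exact ⟨polarity_distinct b vs, polarity_bigAnd (List.forall_mem_map.2 fun v _ => h v)⟩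

theorem polarity_atMostCompl {b : Bool} {t : Var n → MIL Pred} (h : ∀ v, Polarity b (t v)) (N : ℕ) :
    Polarity b (atMostCompl N t) := by
  refine polarity_forallU (fun vs => ?_) (N + 1) []
  -- The premise `distinct` stands under a negation, harmlessly, since it contains no predicate
  -- symbol.
  exact ⟨polarity_distinct (!b) vs, polarity_bigOr (List.forall_mem_map.2 fun v _ => h v)⟩

theorem isPositive_pposConj [∀ k, Fintype (Pred k)] (lo : Cell Pred → ℕ) (hi : Cell Pred → ℕ∞) :
    (pposConj lo hi).IsPositive := by
  refine ⟨polarity_bigAnd ?_, polarity_bigAnd ?_⟩ <;> simp only [List.forall_mem_map]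
  · refine fun X _ => polarity_atLeast (fun v => polarity_bigOr ?_) _
    simp only [List.forall_mem_map]
    refine fun c _ => ⟨polarity_rangesAre _ _ _, polarity_bigAnd ?_⟩
    simp only [List.forall_mem_map]
    exact fun p _ => isPositive_holds _ _
  · intro X _
    rw [atMostCells]
    split_ifs
    · trivial
    refine polarity_atMostCompl (fun v => polarity_bigAnd ?_) _
    simp only [List.forall_mem_map]
    refine fun c _ => ⟨polarity_rangesAre _ _ _, polarity_bigOr ?_⟩
    simp only [List.forall_mem_map]
    exact fun p _ => isPositive_holds _ _

theorem isPositive_ppos [∀ k, Fintype (Pred k)] (φ : MIL Pred) : (ppos φ).IsPositive := by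
  refine polarity_bigOr ?_
  simp only [List.forall_mem_map]
  exact fun f _ => isPositive_pposConj _ _

end MIL

/-! ### The finite universe -/

/-- The number of an instance. -/
def Univ.val {n : ℕ} {M : Fin n → ℕ} (u : Univ M) : ℕ := u.1

theorem Univ.val_injective {n : ℕ} {M : Fin n → ℕ} :
    Function.Injective (Univ.val : Univ M → ℕ) := Subtype.val_injective

theorem Univ.one_le_val {n : ℕ} {M : Fin n → ℕ} (u : Univ M) : 1 ≤ u.val := u.2.1

instance Univ.instFinite {n : ℕ} (M : Fin n → ℕ) : Finite (Univ M) := by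
  refine Set.Finite.to_subtype ((Set.finite_Iic (∑ k, M k)).subset ?_)
  rintro u ⟨-, k, hk⟩
  exact hk.trans (Finset.single_le_sum (f := M) (fun _ _ => Nat.zero_le _) (Finset.mem_univ k))

namespace MIL

variable {n : ℕ} {Pred : Fin n → Type} {M : Fin n → ℕ}

/-! ### Cells -/

section CellOf

variable [∀ k, Fintype (Pred k)]

open Classical in
/-- The cell to which an element of the universe belongs. -/
noncomputable def cellOf (I : Interp Pred M) (u : Univ M) : Cell Pred :=
  (Finset.univ.filter fun k => u.1 ≤ M k,
    Finset.univ.filter fun p : Σ k, Pred k => u.1 ≤ M p.1 ∧ u ∈ I p.1 p.2)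

theorem inCell_iff (I : Interp Pred M) (u : Univ M) (c : Cell Pred) :
    InCell I u c ↔ cellOf I u = c := by
  rw [Prod.ext_iff, Finset.ext_iff, Finset.ext_iff]
  simp only [InCell, cellOf, Finset.mem_filter, Finset.mem_univ, true_and]
  exact and_congr (forall_congr' fun _ => Iff.comm) (forall_congr' fun _ => Iff.comm)

theorem mem_cellOf_fst {I : Interp Pred M} {u : Univ M} {k : Fin n} :
    k ∈ (cellOf I u).1 ↔ u.val ≤ M k := by simp [cellOf, Univ.val]

theorem mem_cellOf_snd {I : Interp Pred M} {u : Univ M} {p : Σ k, Pred k} :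
    p ∈ (cellOf I u).2 ↔ u.val ≤ M p.1 ∧ u ∈ I p.1 p.2 := by simp [cellOf, Univ.val]

theorem cellCard_eq (I : Interp Pred M) (c : Cell Pred) :
    cellCard I c = {u | cellOf I u = c}.ncard := by
  simp only [cellCard, inCell_iff]

/-! ### Sentences cannot distinguish structures with the same cell cardinalities up to their rank -/

variable {M' : Fin n → ℕ}

/-- The elements of the cell `c` that are not related to anything. -/
def unmatched {X : Type} (I : Interp Pred M) (R : Univ M → X → Prop) (c : Cell Pred) :
    Set (Univ M) := {u | cellOf I u = c ∧ ∀ x, ¬ R u x}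

/-- The positions of the Ehrenfeucht–Fraïssé game from which `q` more rounds can be played: a partial
injection that preserves cells, such that the numbers of unmatched elements of each cell agree up to
`q`. -/
structure BackForth (I : Interp Pred M) (I' : Interp Pred M') (q : ℕ)
    (R : Univ M → Univ M' → Prop) : Prop where
  inj : ∀ {a a' b b'}, R a a' → R b b' → (a = b ↔ a' = b')
  cell : ∀ {a a'}, R a a' → cellOf I a = cellOf I' a'
  card : ∀ c, min (unmatched I R c).ncard q = min (unmatched I' (fun x y => R y x) c).ncard q

theorem BackForth.symm {I : Interp Pred M} {I' : Interp Pred M'} {q : ℕ}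
    {R : Univ M → Univ M' → Prop} (h : BackForth I I' q R) :
    BackForth I' I q fun x y => R y x :=
  ⟨fun h₁ h₂ => (h.inj h₁ h₂).symm, fun h₁ => (h.cell h₁).symm, fun c => (h.card c).symm⟩

theorem BackForth.mono {I : Interp Pred M} {I' : Interp Pred M'} {q q' : ℕ}
    {R : Univ M → Univ M' → Prop} (h : BackForth I I' q R) (hq : q' ≤ q) :
    BackForth I I' q' R :=
  ⟨h.inj, h.cell, fun c => by have := h.card c; omega⟩

/-- Relating a fresh `a` removes `a`, and nothing else, from the unmatched elements, so only the
count of its own cell drops. -/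
theorem ncard_unmatched_insert {X : Type} (I : Interp Pred M) (R : Univ M → X → Prop) {a : Univ M}
    (x₀ : X) (ha : ∀ x, ¬ R a x) (c : Cell Pred) [Decidable (cellOf I a = c)] :
    (unmatched I R c).ncard =
      (unmatched I (fun u x => R u x ∨ u = a ∧ x = x₀) c).ncard +
        if cellOf I a = c then 1 else 0 := by
  have key : unmatched I (fun u x => R u x ∨ u = a ∧ x = x₀) c = unmatched I R c \ {a} := by
    ext u
    simp only [unmatched, Set.mem_ofPred_eq, Set.mem_sdiff, Set.mem_singleton_iff, not_or, not_and,
      forall_and, and_assoc]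
    exact and_congr_right fun _ => and_congr_right fun _ =>
      ⟨fun h hu => h x₀ hu rfl, fun h x hu => absurd hu h⟩
  rw [key]
  split_ifs with hc
  · have hmem : a ∈ unmatched I R c := ⟨hc, ha⟩
    exact (Set.ncard_sdiff_singleton_add_one hmem).symm
  · rw [Set.sdiff_singleton_eq_self fun h => hc h.1, add_zero]

/-- A matched `a` is answered by its partner. An unmatched one makes the unmatched count of its cell
positive, hence also the count on the other side, because they agree up to `q + 1 ≥ 1`. Pairing two
such elements lowers both counts by one, which leaves agreement up to `q`. -/
theorem BackForth.extend {I : Interp Pred M} {I' : Interp Pred M'} {q : ℕ}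
    {R : Univ M → Univ M' → Prop} (h : BackForth I I' (q + 1) R) (a : Univ M) :
    ∃ (a' : Univ M') (R' : Univ M → Univ M' → Prop), BackForth I I' q R' ∧ R' a a' ∧
      ∀ b b', R b b' → R' b b' := by
  classical
  by_cases ha : ∃ a', R a a'
  · obtain ⟨a', ha'⟩ := ha
    exact ⟨a', R, h.mono (Nat.le_succ q), ha', fun _ _ => id⟩
  push Not at ha
  have hpos : 0 < (unmatched I R (cellOf I a)).ncard :=
    (Set.ncard_pos).2 ⟨a, rfl, ha⟩
  have hpos' : 0 < (unmatched I' (fun x y => R y x) (cellOf I a)).ncard := by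
    have := h.card (cellOf I a); omega
  obtain ⟨a', hcell, ha'⟩ := (Set.ncard_pos).1 hpos'
  refine ⟨a', fun u x => R u x ∨ u = a ∧ x = a', ⟨?_, ?_, fun c => ?_⟩, .inr ⟨rfl, rfl⟩,
    fun _ _ => .inl⟩
  · rintro b b' d d' (hb | ⟨rfl, rfl⟩) (hd | ⟨rfl, rfl⟩)
    · exact h.inj hb hd
    · exact ⟨by rintro rfl; exact absurd hb (ha _), by rintro rfl; exact absurd hb (ha' _)⟩
    · exact ⟨by rintro rfl; exact absurd hd (ha _), by rintro rfl; exact absurd hd (ha' _)⟩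
    · simp
  · rintro b b' (hb | ⟨rfl, rfl⟩)
    · exact h.cell hb
    · exact hcell.symm
  · have h₁ := ncard_unmatched_insert I R a' ha c
    have h₂ := ncard_unmatched_insert I' (fun x y => R y x) a ha' c
    rw [hcell] at h₂
    have h₃ := h.card c
    have h₄ : unmatched I' (fun u x => R x u ∨ x = a ∧ u = a') c =
        unmatched I' (fun u x => R x u ∨ u = a' ∧ x = a) c := by
      simp only [and_comm]
    rw [h₄]
    split_ifs at h₁ h₂ <;> omega

/-- The valuations `ν` and `ν'` of the variable `v` are related by `R`. -/
def Matched (R : Univ M → Univ M' → Prop) (ν ν' : Var n → ℕ) (v : Var n) : Prop :=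
  ∃ a a', R a a' ∧ a.val = ν v ∧ a'.val = ν' v ∧ a.val ≤ M v.1 ∧ a'.val ≤ M' v.1

theorem BackForth.exists_update {I : Interp Pred M} {I' : Interp Pred M'} {q : ℕ}
    {R : Univ M → Univ M' → Prop} (h : BackForth I I' (q + 1) R) {ν ν' : Var n → ℕ} {i : Var n}
    {s : Set (Var n)} (hs : ∀ v ∈ s \ {i}, Matched R ν ν' v) {a : ℕ} (ha : 1 ≤ a)
    (haM : a ≤ M i.1) :
    ∃ a', 1 ≤ a' ∧ a' ≤ M' i.1 ∧ ∃ R', BackForth I I' q R' ∧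
      ∀ v ∈ s, Matched R' (Function.update ν i a) (Function.update ν' i a') v := by
  obtain ⟨a, rfl⟩ : ∃ u : Univ M, u.val = a := ⟨⟨a, ha, i.1, haM⟩, rfl⟩
  obtain ⟨a', R', hR', haa', hsub⟩ := h.extend a
  -- The instance counts may differ, but equal cells have equal range components, so the reply is a
  -- legal value of `i`.
  have ha'M : a'.val ≤ M' i.1 := by
    rw [← mem_cellOf_fst (I := I'), ← hR'.cell haa', mem_cellOf_fst]; exact haM
  refine ⟨a'.val, a'.2.1, ha'M, R', hR', fun v hv => ?_⟩
  by_cases hvi : v = i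
  · subst hvi
    exact ⟨_, a', haa', by simp, by simp, haM, ha'M⟩
  · obtain ⟨b, b', hb, h₁, h₂, h₃⟩ := hs v ⟨hv, hvi⟩
    exact ⟨b, b', hsub _ _ hb, by simpa [hvi] using h₁, by simpa [hvi] using h₂, h₃⟩

theorem Matched.symm {R : Univ M → Univ M' → Prop} {ν ν' : Var n → ℕ} {v : Var n}
    (h : Matched R ν ν' v) : Matched (fun x y => R y x) ν' ν v := by
  obtain ⟨a, a', h, h₁, h₂, h₃, h₄⟩ := h
  exact ⟨a', a, h, h₂, h₁, h₄, h₃⟩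

/-- Equalities are preserved by injectivity, predicates by equality of cells, and each quantifier
spends one round. For the atoms, `Matched` has to include the range bounds, because a cell lists a
predicate only for elements in the range of its type. -/
theorem BackForth.sat_iff {I : Interp Pred M} {I' : Interp Pred M'} (φ : MIL Pred) {q : ℕ}
    {R : Univ M → Univ M' → Prop} {ν ν' : Var n → ℕ} (h : BackForth I I' q R)
    (hq : rank φ ≤ q) (hν : ∀ v ∈ freeVars φ, Matched R ν ν' v) :
    Sat I ν φ ↔ Sat I' ν' φ := by
  induction φ generalizing q R ν ν' with
  | fls => rfl
  | eq i j =>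
    obtain ⟨a, a', ha, h₁, h₂, -⟩ := hν i (by simp [freeVars])
    obtain ⟨b, b', hb, h₃, h₄, -⟩ := hν j (by simp [freeVars])
    have := h.inj ha hb
    simp only [Sat, ← h₁, ← h₂, ← h₃, ← h₄]
    exact ⟨fun e => congrArg _ (this.1 (Univ.val_injective e)),
      fun e => congrArg _ (this.2 (Univ.val_injective e))⟩
  | @pred k p m =>
    obtain ⟨a, a', ha, h₁, h₂, h₃, h₄⟩ := hν (k, m) (by simp only [freeVars]; exact rfl)
    have hc : (⟨k, p⟩ : Σ k, Pred k) ∈ (cellOf I a).2 ↔ ⟨k, p⟩ ∈ (cellOf I' a').2 := by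
      rw [h.cell ha]
    rw [mem_cellOf_snd, mem_cellOf_snd, and_iff_right h₃, and_iff_right h₄] at hc
    simp only [Sat, ← h₁, ← h₂]
    constructor
    · rintro ⟨u, hu, e⟩; rw [Univ.val_injective e] at hu; exact ⟨a', hc.1 hu, rfl⟩
    · rintro ⟨u, hu, e⟩; rw [Univ.val_injective e] at hu; exact ⟨a, hc.2 hu, rfl⟩
  | and φ ψ ihφ ihψ =>
    exact and_congr (ihφ h (le_trans (le_max_left _ _) hq) fun v hv => hν v (.inl hv))
      (ihψ h (le_trans (le_max_right _ _) hq) fun v hv => hν v (.inr hv))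
  | or φ ψ ihφ ihψ =>
    exact or_congr (ihφ h (le_trans (le_max_left _ _) hq) fun v hv => hν v (.inl hv))
      (ihψ h (le_trans (le_max_right _ _) hq) fun v hv => hν v (.inr hv))
  | neg φ ih => exact not_congr (ih h hq hν)
  | ex i φ ih =>
    obtain ⟨q, rfl⟩ : ∃ q', q = q' + 1 := ⟨q - 1, by simp only [rank] at hq; omega⟩
    have hq' : rank φ ≤ q := by simpa [rank] using hq
    constructor
    · rintro ⟨a, ha, haM, hs⟩
      obtain ⟨a', ha', haM', R', hR', hm⟩ := h.exists_update hν ha haM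
      exact ⟨a', ha', haM', (ih hR' hq' hm).1 hs⟩
    · rintro ⟨a, ha, haM, hs⟩
      obtain ⟨a', ha', haM', R', hR', hm⟩ := h.symm.exists_update (fun v hv => (hν v hv).symm) ha haM
      exact ⟨a', ha', haM', (ih hR'.symm hq' fun v hv => (hm v hv).symm).2 hs⟩
  | all i φ ih =>
    obtain ⟨q, rfl⟩ : ∃ q', q = q' + 1 := ⟨q - 1, by simp only [rank] at hq; omega⟩
    have hq' : rank φ ≤ q := by simpa [rank] using hq
    constructor
    · intro hs a ha haM
      obtain ⟨a', ha', haM', R', hR', hm⟩ := h.symm.exists_update (fun v hv => (hν v hv).symm) ha haM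
      exact (ih hR'.symm hq' fun v hv => (hm v hv).symm).1 (hs a' ha' haM')
    · intro hs a ha haM
      obtain ⟨a', ha', haM', R', hR', hm⟩ := h.exists_update hν ha haM
      exact (ih hR' hq' hm).2 (hs a' ha' haM')

theorem IsSentence.isModel_congr {φ : MIL Pred} (hφ : φ.IsSentence) {I : Interp Pred M}
    {I' : Interp Pred M'}
    (h : ∀ c, min (cellCard I c) (rank φ) = min (cellCard I' c) (rank φ)) :
    IsModel I φ ↔ IsModel I' φ := by
  -- The game starts from the empty matching, where the unmatched elements of a cell are the whole
  -- cell.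
  have hB : BackForth I I' (rank φ) fun _ _ => False :=
    ⟨fun h => h.elim, fun h => h.elim, fun c => by simpa [unmatched, cellCard_eq] using h c⟩
  rw [hφ.isModel_iff I 0, hφ.isModel_iff I' 0]
  exact hB.sat_iff φ le_rfl (by rw [show freeVars φ = ∅ from hφ]; simp)

theorem IsSentence.isModel_iff_cardDNF {φ : MIL Pred} (hφ : φ.IsSentence) (I : Interp Pred M) :
    IsModel I φ ↔ ∃ f ∈ cardDNF φ, ∀ c, (f c : ℕ) = min (cellCard I c) (rank φ) := by
  classical
  constructor
  · intro h
    refine ⟨fun c => ⟨min (cellCard I c) (rank φ), by omega⟩, ?_, fun c => rfl⟩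
    exact Finset.mem_filter.2 ⟨Finset.mem_univ _, M, I, h, fun c => rfl⟩
  · rintro ⟨f, hf, hfI⟩
    obtain ⟨-, M', I', hI', hfI'⟩ := Finset.mem_filter.1 hf
    exact (hφ.isModel_congr fun c => by rw [← hfI, ← hfI']).2 hI'

end CellOf

end MIL

/-! ### Assignments with lower and upper bounds -/

/-- The elements that have to be moved along alternating paths when a matching `g` is modified such
that it covers the range of `ι`, by means of the matching `f`. -/
inductive AlternatingReach {A U S : Type*} (f : A → U) (ι : A → S) (g : U → S) : U → Prop
  | intro (a : A) (h : ∀ u, g u = ι a → AlternatingReach f ι g u) : AlternatingReach f ι g (f a)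

/-- The Mendelsohn–Dulmage theorem, in terms of injections: a matching `f` that covers the left
vertices `A ⊆ S` and a matching `g` that covers the right vertices `U` can be combined. -/
theorem exists_injective_extending_range {A U S : Type*} (f : A → U) (ι : A → S) (g : U → S)
    (hf : Function.Injective f) (hι : Function.Injective ι) (hg : Function.Injective g) :
    ∃ h : U → S, Function.Injective h ∧ (∀ u, h u = g u ∨ ∃ a, f a = u ∧ h u = ι a) ∧
      ∀ a, ∃ u, h u = ι a := by
  classical
  -- The combined matching uses `f` on the reached vertices and `g` on all others.
  have hinv : ∀ u, ∃ s, (AlternatingReach f ι g u → ∃ a, f a = u ∧ s = ι a) ∧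
      (¬ AlternatingReach f ι g u → s = g u) := by
    intro u
    by_cases hu : AlternatingReach f ι g u
    · obtain ⟨a, rfl⟩ : ∃ a, f a = u := by
        obtain ⟨a, -⟩ := hu
        exact ⟨a, rfl⟩
      exact ⟨ι a, fun _ => ⟨a, rfl, rfl⟩, fun h => absurd hu h⟩
    · exact ⟨g u, fun h => absurd h hu, fun _ => rfl⟩
  choose h h₁ h₂ using hinv
  have back : ∀ {a u}, AlternatingReach f ι g (f a) → g u = ι a → AlternatingReach f ι g u := by
    intro a u ha hu
    generalize hx : f a = x at ha
    obtain ⟨b, hb⟩ := ha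
    exact hb u (hf hx ▸ hu)
  -- A collision would give `g u' = ι a` with `f a` reached, and then `u'` would be reached as well.
  have cross : ∀ {u u'}, AlternatingReach f ι g u → ¬ AlternatingReach f ι g u' → h u ≠ h u' := by
    intro u u' hu hu' e
    obtain ⟨a, rfl, ha⟩ := h₁ u hu
    exact hu' (back hu (by rw [← h₂ u' hu', ← e, ha]))
  refine ⟨h, fun u u' e => ?_, fun u => ?_, fun a => ?_⟩
  · by_cases hu : AlternatingReach f ι g u <;> by_cases hu' : AlternatingReach f ι g u'
    · obtain ⟨a, rfl, ha⟩ := h₁ u hu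
      obtain ⟨a', rfl, ha'⟩ := h₁ u' hu'
      rw [hι (ha.symm.trans (e.trans ha'))]
    · exact absurd e (cross hu hu')
    · exact absurd e.symm (cross hu' hu)
    · exact hg (by rw [← h₂ u hu, ← h₂ u' hu', e])
  · by_cases hu : AlternatingReach f ι g u
    · exact .inr (h₁ u hu)
    · exact .inl (h₂ u hu)
  · by_cases ha : AlternatingReach f ι g (f a)
    · obtain ⟨b, hb, e⟩ := h₁ _ ha
      exact ⟨f a, by rw [e, hf hb]⟩
    -- If `f a` is not reached, then its only rule fails: some unreached `u` has `g u = ι a` and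
    -- keeps this value.
    · have : ∃ u, g u = ι a ∧ ¬ AlternatingReach f ι g u := by
        by_contra hcon
        push Not at hcon
        exact ha (.intro a hcon)
      obtain ⟨u, hu, hu'⟩ := this
      exact ⟨u, by rw [h₂ u hu', hu]⟩

open Classical in
/-- A Hall-type criterion for the existence of a map `g : U → C` inside the relation `r`, the fibres of
which have prescribed lower and upper bounds. -/
theorem exists_map_card_fiber_between {U C : Type*} [Fintype U] [Fintype C] (r : U → C → Prop)
    (lo hi : C → ℕ) (hle : ∀ c, lo c ≤ hi c)
    (hlo : ∀ X : Finset C, ∑ c ∈ X, lo c ≤ (Finset.univ.filter fun u => ∃ c ∈ X, r u c).card)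
    (hhi : ∀ W : Finset U, W.card ≤ ∑ c ∈ Finset.univ.filter (fun c => ∃ u ∈ W, r u c), hi c) :
    ∃ g : U → C, (∀ u, r u (g u)) ∧ ∀ c,
      lo c ≤ (Finset.univ.filter fun u => g u = c).card ∧
      (Finset.univ.filter fun u => g u = c).card ≤ hi c := by
  -- Hall's theorem for `lo c` copies of each `c`, matched into `U`. A set of copies may be enlarged
  -- to all copies of the same targets, since this does not change its neighbours.
  obtain ⟨f, hf, hfr⟩ := (Fintype.all_card_le_filter_rel_iff_exists_injective
    (fun (a : Σ c, Fin (lo c)) u => r u a.1)).1 fun B => by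
      have hB : B ⊆ (B.image Sigma.fst).sigma fun _ => Finset.univ := fun b hb => by
        simpa using ⟨b.2, hb⟩
      calc B.card ≤ _ := Finset.card_le_card hB
        _ = ∑ c ∈ B.image Sigma.fst, lo c := by simp [Finset.card_sigma]
        _ ≤ _ := hlo _
        _ = _ := by
          congr 1
          ext u
          simp
  -- Hall's theorem again, now matching `U` into `hi c` copies of each `c`.
  obtain ⟨g, hg, hgr⟩ := (Fintype.all_card_le_filter_rel_iff_exists_injective
    (fun u (s : Σ c, Fin (hi c)) => r u s.1)).1 fun W => by
      refine (hhi W).trans (le_of_eq ?_)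
      rw [show (Finset.univ.filter fun s : Σ c, Fin (hi c) => ∃ u ∈ W, r u s.1) =
        (Finset.univ.filter fun c => ∃ u ∈ W, r u c).sigma fun _ => Finset.univ by ext; simp]
      simp [Finset.card_sigma]
  -- The mandatory copies are the first `lo c` of the `hi c` copies. Covering them gives the lower
  -- bound on the fibre, and injectivity gives the upper bound.
  let ι : (Σ c, Fin (lo c)) → Σ c, Fin (hi c) := fun a => ⟨a.1, Fin.castLE (hle _) a.2⟩
  have hι : Function.Injective ι := by
    rintro ⟨c, i⟩ ⟨d, j⟩ e
    obtain ⟨rfl, e⟩ := Sigma.mk.inj_iff.1 e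
    exact congrArg (Sigma.mk c) (Fin.castLE_injective _ (eq_of_heq e))
  obtain ⟨h, hh, hcases, hcov⟩ := exists_injective_extending_range f ι g hf hι hg
  refine ⟨fun u => (h u).1, fun u => ?_, fun c => ⟨?_, ?_⟩⟩
  · rcases hcases u with e | ⟨a, rfl, e⟩
    · simpa only [e] using hgr u
    · simpa only [e] using hfr a
  · choose w hw using hcov
    have : ((Finset.univ : Finset (Fin (lo c))).image fun i => w ⟨c, i⟩) ⊆
        Finset.univ.filter fun u => (h u).1 = c := by
      intro u hu
      obtain ⟨i, -, rfl⟩ := Finset.mem_image.1 hu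
      simp [hw, ι]
    refine le_trans (le_of_eq ?_) (Finset.card_le_card this)
    rw [Finset.card_image_of_injective, Finset.card_univ, Fintype.card_fin]
    intro i j e
    have := hι ((hw _).symm.trans ((congrArg h e).trans (hw _)))
    simpa using this
  · have : (Finset.univ.filter fun u => (h u).1 = c).image h ⊆
        ({c} : Finset C).sigma fun _ => Finset.univ := by
      intro s hs
      obtain ⟨u, hu, rfl⟩ := Finset.mem_image.1 hs
      simpa using hu
    have := Finset.card_le_card this
    rw [Finset.card_image_of_injective _ hh] at this
    simpa [Finset.card_sigma] using this

namespace MIL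

variable {n : ℕ} {Pred : Fin n → Type} {M : Fin n → ℕ}

/-! ### Semantics of cardinality constraints -/

/-- The variables already in `vs` have index at least the remaining count, so the next one, of index
one less than that count, is fresh and leaves their values intact. The element chosen first ends up
last in `l`. -/
theorem sat_existsU (I : Interp Pred M) {body : List (Var n) → MIL Pred}
    {P : List (Univ M) → Prop}
    (h : ∀ ν vs l, vs.map ν = l.map Univ.val → (Sat I ν (body vs) ↔ P l)) (N : ℕ)
    (ν : Var n → ℕ) (vs : List (Var n)) (hvs : ∀ v ∈ vs, N ≤ v.2) (l₀ : List (Univ M))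
    (hl₀ : vs.map ν = l₀.map Univ.val) :
    Sat I ν (existsU N vs body) ↔ ∃ l : List (Univ M), l.length = N ∧ P (l ++ l₀) := by
  induction N generalizing ν vs l₀ with
  | zero => simp [existsU, h ν vs l₀ hl₀]
  | succ N ih =>
    have hupd : ∀ (k : Fin n) (a : Univ M),
        ((k, N) :: vs).map (Function.update ν (k, N) a.val) = (a :: l₀).map Univ.val := by
      intro k a
      rw [List.map_cons, List.map_cons, Function.update_self, ← hl₀]
      congr 1
      refine List.map_congr_left fun v hv => Function.update_of_ne ?_ _ _
      rintro rfl
      exact absurd (hvs _ hv) (by simp)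
    have hvs' : ∀ k : Fin n, ∀ v ∈ (k, N) :: vs, N ≤ v.2 := by
      intro k v hv
      rcases List.mem_cons.1 hv with rfl | hv
      · exact le_rfl
      · exact (Nat.le_succ N).trans (hvs v hv)
    rw [existsU, sat_bigOr_map]
    simp only [List.mem_finRange, true_and, Sat]
    constructor
    · rintro ⟨k, a, ha, haM, hs⟩
      obtain ⟨a, rfl⟩ : ∃ u : Univ M, u.val = a := ⟨⟨a, ha, k, haM⟩, rfl⟩
      obtain ⟨l, rfl, hP⟩ := (ih _ _ (hvs' k) _ (hupd k a)).1 hs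
      exact ⟨l ++ [a], by simp, by simpa using hP⟩
    · rintro ⟨l, hl, hP⟩
      obtain rfl | ⟨l, a, rfl⟩ := List.eq_nil_or_concat l
      · simp at hl
      · obtain ⟨ha, k, haM⟩ := a.2
        exact ⟨k, a.val, ha, haM, (ih _ _ (hvs' k) _ (hupd k a)).2
          ⟨l, by simpa using hl, by simpa using hP⟩⟩

theorem sat_forallU (I : Interp Pred M) {body : List (Var n) → MIL Pred}
    {P : List (Univ M) → Prop}
    (h : ∀ ν vs l, vs.map ν = l.map Univ.val → (Sat I ν (body vs) ↔ P l)) (N : ℕ)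
    (ν : Var n → ℕ) (vs : List (Var n)) (hvs : ∀ v ∈ vs, N ≤ v.2) (l₀ : List (Univ M))
    (hl₀ : vs.map ν = l₀.map Univ.val) :
    Sat I ν (forallU N vs body) ↔ ∀ l : List (Univ M), l.length = N → P (l ++ l₀) := by
  have hdual : ∀ N vs ν, Sat I ν (forallU N vs body) ↔
      ¬ Sat I ν (existsU N vs fun vs => neg (body vs)) := by
    intro N
    induction N with
    | zero => intro vs ν; simp [forallU, existsU, Sat]
    | succ N ih =>
      intro vs ν
      rw [forallU, existsU, sat_bigAnd_map, sat_bigOr_map]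
      simp only [Sat, ih]
      push Not
      rfl
  rw [hdual, sat_existsU I (body := fun vs => neg (body vs)) (P := fun l => ¬ P l)
    (fun ν vs l hl => not_congr (h ν vs l hl)) N ν vs
    hvs l₀ hl₀]
  push Not
  rfl

theorem forall_mem_iff_of_map_eq {α β γ : Type*} {f : α → γ} {g : β → γ} {P : α → Prop}
    {Q : β → Prop} (h : ∀ a b, g b = f a → (P a ↔ Q b)) {l : List α} {l' : List β}
    (e : l.map f = l'.map g) : (∀ a ∈ l, P a) ↔ ∀ b ∈ l', Q b := by
  induction l generalizing l' with
  | nil => simp [List.map_eq_nil_iff.1 e.symm]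
  | cons a l ih =>
    cases l' with
    | nil => simp at e
    | cons b l' =>
      rw [List.map_cons, List.map_cons, List.cons.injEq] at e
      rw [List.forall_mem_cons, List.forall_mem_cons, h a b e.1.symm, ih e.2]

theorem exists_nodup_list_iff {α : Type*} [Finite α] (Q : α → Prop) (N : ℕ) :
    (∃ l : List α, l.length = N ∧ l.Nodup ∧ ∀ u ∈ l, Q u) ↔ N ≤ {u | Q u}.ncard := by
  classical
  constructor
  · rintro ⟨l, rfl, hl, hQ⟩
    rw [← List.toFinset_card_of_nodup hl, ← Set.ncard_coe_finset]
    exact Set.ncard_le_ncard (fun u hu => hQ u (by simpa using hu))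
  · intro h
    obtain ⟨t, ht, rfl⟩ := Set.exists_subset_card_eq h
    refine ⟨t.toFinite.toFinset.toList, ?_, Finset.nodup_toList _, fun u hu => ht (by simpa using hu)⟩
    rw [Finset.length_toList, Set.ncard_eq_toFinset_card t]

theorem sat_atLeast (I : Interp Pred M) (ν : Var n → ℕ) {t : Var n → MIL Pred} {Q : Univ M → Prop}
    (h : ∀ ν v (u : Univ M), u.val = ν v → (Sat I ν (t v) ↔ Q u)) (N : ℕ) :
    Sat I ν (atLeast N t) ↔ N ≤ {u | Q u}.ncard := by
  rw [atLeast, sat_existsU I (P := fun l => l.Nodup ∧ ∀ a ∈ l, Q a) (fun ν vs l hl => ?_) N ν []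
    (by simp) [] rfl, ← exists_nodup_list_iff]
  · simp only [List.append_nil]
  · simp only [Sat, sat_distinct, sat_bigAnd_map, hl,
      List.nodup_map_iff Univ.val_injective, forall_mem_iff_of_map_eq (h ν) hl]

theorem sat_atMostCompl (I : Interp Pred M) (ν : Var n → ℕ) {t : Var n → MIL Pred}
    {Q : Univ M → Prop} (h : ∀ ν v (u : Univ M), u.val = ν v → (Sat I ν (t v) ↔ ¬ Q u)) (N : ℕ) :
    Sat I ν (atMostCompl N t) ↔ {u | Q u}.ncard ≤ N := by
  rw [atMostCompl, sat_forallU I (P := fun l => ¬ (l.Nodup ∧ ∀ a ∈ l, Q a)) (fun ν vs l hl => ?_)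
    (N + 1) ν [] (by simp) [] rfl, ← not_lt, ← Nat.succ_le_iff, ← exists_nodup_list_iff]
  · simp only [List.append_nil]
    push Not
    rfl
  · rw [← forall_mem_iff_of_map_eq (P := fun v => ¬ Sat I ν (t v)) (Q := Q)
      (fun v u e => by rw [h ν v u e, not_not]) hl]
    simp only [sat_imp, sat_distinct, sat_bigOr_map, hl,
      List.nodup_map_iff Univ.val_injective]
    push Not
    rfl

theorem sat_inRange (I : Interp Pred M) (ν : Var n → ℕ) (k : Fin n) (v : Var n) :
    Sat I ν (inRange k v) ↔ 1 ≤ ν v ∧ ν v ≤ M k := by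
  -- The index shift in `inRange` prevents capture of `v`.
  have hv : v ≠ (k, v.2 + 1) := fun e => by simpa using congrArg Prod.snd e
  simp only [inRange, Sat, Function.update_self, Function.update_of_ne hv]
  exact ⟨fun ⟨a, h₁, h₂, e⟩ => e ▸ ⟨h₁, h₂⟩, fun ⟨h₁, h₂⟩ => ⟨_, h₁, h₂, rfl⟩⟩

theorem sat_holds (I : Interp Pred M) (ν : Var n → ℕ) {k : Fin n} (p : Pred k) (v : Var n) :
    Sat I ν (holds p v) ↔ ν v ≤ M k ∧ ∃ u ∈ I k p, u.val = ν v := by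
  have hv : v ≠ (k, v.2 + 1) := fun e => by simpa using congrArg Prod.snd e
  simp only [holds, Sat, Function.update_self, Function.update_of_ne hv]
  exact ⟨fun ⟨a, h₁, h₂, e, h⟩ => e ▸ ⟨h₂, h⟩,
    fun ⟨h₂, u, hu, e⟩ => ⟨_, e ▸ u.2.1, h₂, rfl, u, hu, e⟩⟩

theorem sat_rangesAre (I : Interp Pred M) (ν : Var n → ℕ) (A : Finset (Fin n)) (v : Var n) :
    Sat I ν (rangesAre A v) ↔ ∀ k, k ∈ A ↔ (1 ≤ ν v ∧ ν v ≤ M k) := by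
  rw [rangesAre, sat_bigAnd_map]
  simp only [List.mem_finRange, forall_true_left]
  refine forall_congr' fun k => ?_
  split_ifs with hk <;> simp [hk, Sat, sat_inRange]

/-- The order on cells: the same ranges, and fewer predicates. -/
def CellLE (c d : Cell Pred) : Prop := c.1 = d.1 ∧ c.2 ⊆ d.2

theorem CellLE.refl (c : Cell Pred) : CellLE c c := ⟨rfl, Finset.Subset.refl _⟩

theorem CellLE.trans {c d e : Cell Pred} (h : CellLE c d) (h' : CellLE d e) : CellLE c e :=
  ⟨h.1.trans h'.1, h.2.trans h'.2⟩

section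

variable [∀ k, Fintype (Pred k)]

theorem sat_cellPos (I : Interp Pred M) (ν : Var n → ℕ) (c : Cell Pred) (v : Var n) (u : Univ M)
    (hu : u.val = ν v) : Sat I ν (cellPos c v) ↔ CellLE c (cellOf I u) := by
  simp only [cellPos, Sat, sat_rangesAre, sat_bigAnd_map, sat_holds, ← hu, CellLE,
    Finset.ext_iff, mem_cellOf_fst, u.one_le_val, true_and, Finset.subset_iff, mem_cellOf_snd,
    Finset.mem_toList]
  refine and_congr_right fun _ => forall₂_congr fun p _ => and_congr_right fun _ => ?_
  exact ⟨fun ⟨w, hw, e⟩ => Univ.val_injective e ▸ hw, fun h => ⟨u, h, rfl⟩⟩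

theorem sat_cellNegCompl (I : Interp Pred M) (ν : Var n → ℕ) (c : Cell Pred) (v : Var n)
    (u : Univ M) (hu : u.val = ν v) :
    Sat I ν (cellNegCompl c v) ↔ ¬ CellLE (cellOf I u) c := by
  simp only [cellNegCompl, Sat, sat_rangesAre, sat_bigOr_map, sat_holds, ← hu,
    CellLE, Finset.ext_iff, mem_cellOf_fst, u.one_le_val, true_and, Finset.subset_iff, mem_cellOf_snd,
    Finset.mem_toList, Finset.mem_compl]
  rw [not_and_or]
  refine or_congr (not_congr (forall_congr' fun _ => Iff.comm)) ?_
  simp only [not_forall]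
  refine exists_congr fun p => ?_
  constructor
  · rintro ⟨h, h', w, hw, e⟩
    exact ⟨⟨h', Univ.val_injective e ▸ hw⟩, h⟩
  · rintro ⟨⟨h', hw⟩, h⟩
    exact ⟨h, h', u, hw, rfl⟩

end

end MIL

namespace MIL

variable {n : ℕ} {Pred : Fin n → Type} {M : Fin n → ℕ} [∀ k, Fintype (Pred k)]

/-! ### Correctness of the positivation operator -/

theorem sat_atMostCells (I : Interp Pred M) (ν : Var n → ℕ) (X : Finset (Cell Pred)) (b : ℕ∞) :
    Sat I ν (atMostCells X b) ↔ ({u | ∃ c ∈ X, CellLE (cellOf I u) c}.ncard : ℕ∞) ≤ b := by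
  rw [atMostCells]
  split_ifs with hb
  · simp [hb]
  · rw [sat_atMostCompl I ν (Q := fun u => ∃ c ∈ X, CellLE (cellOf I u) c), ← Nat.cast_le (α := ℕ∞),
      ENat.natCast_toNat hb]
    intro ν v u hu
    simp only [sat_bigAnd_map, sat_cellNegCompl I ν _ v u hu, Finset.mem_toList]
    push Not
    rfl

theorem sat_pposConj (I : Interp Pred M) (ν : Var n → ℕ) (lo : Cell Pred → ℕ)
    (hi : Cell Pred → ℕ∞) :
    Sat I ν (pposConj lo hi) ↔
      (∀ X, UpClosed X → ∑ c ∈ X, lo c ≤ {u | ∃ c ∈ X, CellLE c (cellOf I u)}.ncard) ∧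
      ∀ X, DownClosed X →
        ({u | ∃ c ∈ X, CellLE (cellOf I u) c}.ncard : ℕ∞) ≤ ∑ c ∈ X, hi c := by
  classical
  simp only [pposConj, Sat, sat_bigAnd_map, Finset.mem_toList, Finset.mem_filter, Finset.mem_univ,
    true_and, sat_atMostCells]
  refine and_congr_left fun _ => forall₂_congr fun X _ => ?_
  refine sat_atLeast I ν (Q := fun u => ∃ c ∈ X, CellLE c (cellOf I u)) (fun ν v u hu => ?_) _
  simp only [sat_bigOr_map, sat_cellPos I ν _ v u hu, Finset.mem_toList]

theorem ncard_cellOf_mem (I : Interp Pred M) (X : Finset (Cell Pred)) :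
    {u | cellOf I u ∈ X}.ncard = ∑ c ∈ X, cellCard I c := by
  classical
  have := Fintype.ofFinite (Univ M)
  have hcard : ∀ c, cellCard I c = (Finset.univ.filter fun u => cellOf I u = c).card := by
    intro c
    rw [cellCard_eq, ← Set.ncard_coe_finset]
    simp
  rw [show {u | cellOf I u ∈ X} = ((Finset.univ.filter fun u => cellOf I u ∈ X : Finset (Univ M)) :
    Set (Univ M)) by simp, Set.ncard_coe_finset,
    Finset.card_eq_sum_card_fiberwise (f := cellOf I) (t := X) (fun u hu => by simpa using hu)]
  refine Finset.sum_congr rfl fun c hc => ?_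
  rw [hcard, Finset.filter_filter]
  congr 1
  ext u
  simp only [Finset.mem_filter, Finset.mem_univ, true_and]
  exact ⟨fun h => h.2, fun h => ⟨h ▸ hc, h⟩⟩

/-- A conjunction of cardinality constraints implies its positivation. -/
theorem sat_pposConj_of_cellCard (I : Interp Pred M) (ν : Var n → ℕ) {lo : Cell Pred → ℕ}
    {hi : Cell Pred → ℕ∞} (hlo : ∀ c, lo c ≤ cellCard I c)
    (hhi : ∀ c, (cellCard I c : ℕ∞) ≤ hi c) : Sat I ν (pposConj lo hi) := by
  refine (sat_pposConj I ν lo hi).2 ⟨fun X _ => ?_, fun X hX => ?_⟩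
  · calc ∑ c ∈ X, lo c ≤ ∑ c ∈ X, cellCard I c := Finset.sum_le_sum fun c _ => hlo c
      _ = {u | cellOf I u ∈ X}.ncard := (ncard_cellOf_mem I X).symm
      _ ≤ _ := Set.ncard_le_ncard fun u hu => by exact ⟨_, hu, CellLE.refl _⟩
  · calc ({u | ∃ c ∈ X, CellLE (cellOf I u) c}.ncard : ℕ∞)
        ≤ ({u | cellOf I u ∈ X}.ncard : ℕ∞) := by
          -- Downward closure puts the cell of `u` itself into `X`.
          refine Nat.cast_le.2 (Set.ncard_le_ncard ?_)
          rintro u ⟨c, hc, h⟩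
          exact hX c hc _ h.1.symm h.2
      _ = ∑ c ∈ X, (cellCard I c : ℕ∞) := by rw [ncard_cellOf_mem, Nat.cast_sum]
      _ ≤ _ := Finset.sum_le_sum fun c _ => hhi c

/-- Each assignment of smaller cells comes from a smaller structure. -/
theorem exists_le_cellOf_eq (I : Interp Pred M) (g : Univ M → Cell Pred)
    (hg : ∀ u, CellLE (g u) (cellOf I u)) : ∃ J ≤ I, ∀ u, cellOf J u = g u := by
  have hmem : ∀ {u} {p : Σ k, Pred k}, p ∈ (g u).2 → u.val ≤ M p.1 ∧ u ∈ I p.1 p.2 :=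
    fun {u} {p} hp => mem_cellOf_snd.1 ((hg u).2 hp)
  refine ⟨fun k p => {u | ⟨k, p⟩ ∈ (g u).2}, fun k p u hu => (hmem hu).2, fun u => ?_⟩
  refine Prod.ext ?_ ?_
  · rw [(hg u).1]
    ext k
    rw [mem_cellOf_fst, mem_cellOf_fst]
  · ext p
    rw [mem_cellOf_snd]
    exact ⟨fun h => h.2, fun h => ⟨(hmem h).1, h⟩⟩

/-- Below each model of the positivation of a conjunction of cardinality constraints, there is a model
of the conjunction. -/
theorem exists_le_of_sat_pposConj (I : Interp Pred M) (ν : Var n → ℕ) {lo : Cell Pred → ℕ}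
    {hi : Cell Pred → ℕ∞} (hle : ∀ c, (lo c : ℕ∞) ≤ hi c) (h : Sat I ν (pposConj lo hi)) :
    ∃ J ≤ I, ∀ c, lo c ≤ cellCard J c ∧ (cellCard J c : ℕ∞) ≤ hi c := by
  classical
  have := Fintype.ofFinite (Univ M)
  obtain ⟨hlo, hhi⟩ := (sat_pposConj I ν lo hi).1 h
  -- An infinite bound is replaced by a number that no fibre can exceed and that is still at least
  -- `lo c`.
  let hi' : Cell Pred → ℕ := fun c => if hi c = ⊤ then lo c + Fintype.card (Univ M) else (hi c).toNat
  have hhi' : ∀ c, (hi' c : ℕ∞) ≤ hi c := by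
    intro c
    by_cases hc : hi c = ⊤
    · simp [hc]
    · simp [hi', hc, ENat.natCast_toNat hc]
  obtain ⟨g, hg, hcard⟩ := exists_map_card_fiber_between (fun u c => CellLE c (cellOf I u)) lo hi'
    (fun c => by
      by_cases hc : hi c = ⊤
      · simp [hi', hc]
      · simp only [hi', hc, if_false]
        rw [← Nat.cast_le (α := ℕ∞), ENat.natCast_toNat hc]
        exact hle c)
    (fun X => by
      -- The upward closure of `X` has the same elements above it and a sum at least as large, so
      -- its constraint gives Hall's condition for `X`.
      let Y : Finset (Cell Pred) := Finset.univ.filter fun d => ∃ c ∈ X, CellLE c d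
      have hY : UpClosed Y := by
        intro c hc d h₁ h₂
        obtain ⟨-, e, he, hec⟩ := Finset.mem_filter.1 hc
        exact Finset.mem_filter.2 ⟨Finset.mem_univ _, e, he, hec.trans ⟨h₁, h₂⟩⟩
      calc ∑ c ∈ X, lo c ≤ ∑ c ∈ Y, lo c := Finset.sum_le_sum_of_subset fun c hc =>
            Finset.mem_filter.2 ⟨Finset.mem_univ _, c, hc, CellLE.refl c⟩
        _ ≤ _ := hlo Y hY
        _ ≤ _ := by
          rw [← Set.ncard_coe_finset]
          refine Set.ncard_le_ncard ?_
          rintro u ⟨c, hc, hcu⟩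
          obtain ⟨-, e, he, hec⟩ := Finset.mem_filter.1 hc
          exact Finset.mem_coe.2 (Finset.mem_filter.2 ⟨Finset.mem_univ _, e, he, hec.trans hcu⟩))
    (fun W => by
      -- The cells available to `W` form a downward closed set, and `W` is among the elements that
      -- its constraint counts. If one of these cells is unbounded, its `hi'` alone exceeds the size
      -- of `W` or equals it.
      set Y : Finset (Cell Pred) := Finset.univ.filter fun c => ∃ u ∈ W, CellLE c (cellOf I u)
        with hYdef
      have hY : DownClosed Y := by
        intro c hc d h₁ h₂
        obtain ⟨-, u, hu, huc⟩ := Finset.mem_filter.1 hc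
        exact Finset.mem_filter.2 ⟨Finset.mem_univ _, u, hu, CellLE.trans ⟨h₁.symm, h₂⟩ huc⟩
      by_cases htop : ∃ c ∈ Y, hi c = ⊤
      · obtain ⟨c, hc, hct⟩ := htop
        calc W.card ≤ Fintype.card (Univ M) := Finset.card_le_univ W
          _ ≤ hi' c := by simp [hi', hct]
          _ ≤ _ := Finset.single_le_sum (fun _ _ => Nat.zero_le _) hc
      · push Not at htop
        have hsum : ∑ c ∈ Y, hi c = ((∑ c ∈ Y, hi' c : ℕ) : ℕ∞) := by
          rw [Nat.cast_sum]
          refine Finset.sum_congr rfl fun c hc => ?_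
          simp only [hi', htop c hc, if_false, ENat.natCast_toNat (htop c hc)]
        have h₁ := hhi Y hY
        rw [hsum, Nat.cast_le] at h₁
        refine le_trans ?_ h₁
        rw [← Set.ncard_coe_finset]
        exact Set.ncard_le_ncard fun u hu => ⟨cellOf I u, Finset.mem_filter.2
          ⟨Finset.mem_univ _, u, hu, CellLE.refl _⟩, CellLE.refl _⟩)
  obtain ⟨J, hJ, hJg⟩ := exists_le_cellOf_eq I g hg
  refine ⟨J, hJ, fun c => ?_⟩
  have hc := hcard c
  rw [← Set.ncard_coe_finset, Finset.coe_filter_univ] at hc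
  rw [cellCard_eq]
  simp only [hJg]
  exact ⟨hc.1, le_trans (Nat.cast_le.2 hc.2) (hhi' c)⟩

theorem IsSentence.isModel_ppos {φ : MIL Pred} (hφ : φ.IsSentence) {I : Interp Pred M}
    (h : IsModel I φ) : IsModel I (ppos φ) := by
  classical
  obtain ⟨f, hf, hfI⟩ := (hφ.isModel_iff_cardDNF I).1 h
  intro ν
  rw [ppos, sat_bigOr_map]
  refine ⟨f, Finset.mem_toList.2 hf, sat_pposConj_of_cellCard I ν (fun c => ?_) fun c => ?_⟩
  · rw [hfI]
    exact min_le_left _ _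
  · split_ifs with hc
    · have := hfI c
      exact Nat.cast_le.2 (by omega)
    · exact le_top

theorem IsSentence.exists_le_isModel {φ : MIL Pred} (hφ : φ.IsSentence) {I : Interp Pred M}
    (h : IsModel I (ppos φ)) : ∃ J ≤ I, IsModel J φ := by
  classical
  have h₀ := h 0
  rw [ppos, sat_bigOr_map] at h₀
  obtain ⟨f, hf, hs⟩ := h₀
  obtain ⟨J, hJ, hcard⟩ := exists_le_of_sat_pposConj I 0 (fun c => by split_ifs <;> simp) hs
  refine ⟨J, hJ, (hφ.isModel_iff_cardDNF J).2 ⟨f, Finset.mem_toList.1 hf, fun c => ?_⟩⟩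
  obtain ⟨h₁, h₂⟩ := hcard c
  -- An entry below the rank fixes the cardinality by equal bounds. Any other entry equals the rank,
  -- and then the lower bound alone determines the truncated value.
  have h₃ := (f c).2
  split_ifs at h₂ with hc
  · have := Nat.cast_le.1 h₂
    omega
  · omega

/-- Purely order-theoretic from here: the models of `φ` are among those of `ppos φ` and lie below
each of them, so the minimal ones coincide. -/
theorem IsSentence.isPositivation_ppos {φ : MIL Pred} (hφ : φ.IsSentence) :
    IsPositivation φ (ppos φ) := by
  refine ⟨isSentence_ppos φ, isPositive_ppos φ, fun M I => ⟨fun h => ?_, fun h => ?_⟩⟩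
  · refine ⟨hφ.isModel_ppos h.1, fun J hJ hJI => ?_⟩
    obtain ⟨K, hK, hKφ⟩ := hφ.exists_le_isModel hJ
    exact (h.2 hKφ (hK.trans hJI)).trans hK
  · obtain ⟨J, hJ, hJφ⟩ := hφ.exists_le_isModel h.1
    have hIJ : I ≤ J := h.2 (hφ.isModel_ppos hJφ) hJ
    exact ⟨le_antisymm hJ hIJ ▸ hJφ, fun K hK hKI => h.2 (hφ.isModel_ppos hK) hKI⟩

end MIL

namespace MIL

variable {n : ℕ} {Pred : Fin n → Type} {M : Fin n → ℕ}

/-! ### Dualisation, blocks of quantifiers and minimal models -/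

/-- De Morgan's laws, with complementation of the structure compensating for the unchanged atoms.
Free variables must be in range: at a value outside the universe an atom is false both in `I` and in
its complement. -/
theorem sat_dual (I : Interp Pred M) (φ : MIL Pred) {ν : Var n → ℕ}
    (hν : ∀ v ∈ freeVars φ, 1 ≤ ν v ∧ ν v ≤ M v.1) :
    Sat I ν (dual φ) ↔ ¬ Sat (fun k p => (I k p)ᶜ) ν φ := by
  have upd : ∀ {i : Var n} {s : Set (Var n)} {ν : Var n → ℕ} {a : ℕ},
      (∀ v ∈ s \ {i}, 1 ≤ ν v ∧ ν v ≤ M v.1) → 1 ≤ a → a ≤ M i.1 →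
      ∀ v ∈ s, 1 ≤ Function.update ν i a v ∧ Function.update ν i a v ≤ M v.1 := by
    intro i s ν a h h₁ h₂ v hv
    by_cases hvi : v = i
    · subst hvi; simp [h₁, h₂]
    · simpa [hvi] using h v ⟨hv, hvi⟩
  induction φ generalizing ν with
  | fls => simp [dual, Sat]
  | eq i j => rfl
  | @pred k p m =>
    obtain ⟨h₁, h₂⟩ := hν (k, m) (by simp only [freeVars]; exact rfl)
    obtain ⟨u, hu⟩ : ∃ u : Univ M, u.val = ν (k, m) := ⟨⟨_, h₁, k, h₂⟩, rfl⟩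
    have key : ∀ A : Set (Univ M), (∃ w ∈ A, w.1 = ν (k, m)) ↔ u ∈ A := fun A =>
      ⟨fun ⟨w, hw, e⟩ => Univ.val_injective (e.trans hu.symm) ▸ hw, fun h => ⟨u, h, hu⟩⟩
    exact (key (I k p)).trans (not_not.symm.trans (not_congr (key (I k p)ᶜ).symm))
  | and φ ψ ihφ ihψ =>
    simp only [dual, Sat, ihφ fun v hv => hν v (.inl hv), ihψ fun v hv => hν v (.inr hv)]
    tauto
  | or φ ψ ihφ ihψ =>
    simp only [dual, Sat, ihφ fun v hv => hν v (.inl hv), ihψ fun v hv => hν v (.inr hv)]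
    tauto
  | neg φ ih => exact not_congr (ih hν)
  | ex i φ ih =>
    simp only [dual, Sat, not_exists, not_and]
    exact forall₃_congr fun a h₁ h₂ => ih (upd hν h₁ h₂)
  | all i φ ih =>
    simp only [dual, Sat, not_forall, exists_prop]
    exact exists_congr fun a => and_congr_right fun h₁ => and_congr_right fun h₂ =>
      ih (upd hν h₁ h₂)

theorem sat_exs (I : Interp Pred M) (l : List (Var n)) (φ : MIL Pred) (ν : Var n → ℕ) :
    Sat I ν (exs l φ) ↔ ∃ ν' : Var n → ℕ, (∀ v, v ∉ l → ν' v = ν v) ∧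
      (∀ v ∈ l, 1 ≤ ν' v ∧ ν' v ≤ M v.1) ∧ Sat I ν' φ := by
  induction l generalizing ν with
  | nil =>
    simp only [exs, List.foldr_nil, List.not_mem_nil, not_false_eq_true, forall_true_left,
      false_imp_iff, implies_true, true_and]
    exact ⟨fun h => ⟨ν, fun _ => rfl, h⟩, fun ⟨ν', e, h⟩ => funext e ▸ h⟩
  | cons i l ih =>
    have hstep : Sat I ν (exs (i :: l) φ) ↔
        ∃ a, 1 ≤ a ∧ a ≤ M i.1 ∧ Sat I (Function.update ν i a) (exs l φ) := Iff.rfl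
    rw [hstep]
    simp only [ih]
    constructor
    · rintro ⟨a, h₁, h₂, ν', e, h, hs⟩
      refine ⟨ν', fun v hv => ?_, fun v hv => ?_, hs⟩
      · rw [List.mem_cons, not_or] at hv
        rw [e v hv.2, Function.update_of_ne hv.1]
      -- A variable that is repeated further inside the block takes the value given there.
      · by_cases hvl : v ∈ l
        · exact h v hvl
        · obtain rfl := (List.mem_cons.1 hv).resolve_right hvl
          rw [e v hvl, Function.update_self]
          exact ⟨h₁, h₂⟩
    · rintro ⟨ν', e, h, hs⟩
      refine ⟨ν' i, (h i (by simp)).1, (h i (by simp)).2, ν', fun v hv => ?_,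
        fun v hv => h v (List.mem_cons_of_mem _ hv), hs⟩
      by_cases hvi : v = i
      · subst hvi; simp
      · rw [Function.update_of_ne hvi, e v (by simp [hvi, hv])]

theorem sat_alls (I : Interp Pred M) (l : List (Var n)) (φ : MIL Pred) (ν : Var n → ℕ) :
    Sat I ν (alls l φ) ↔ ∀ ν' : Var n → ℕ, (∀ v, v ∉ l → ν' v = ν v) →
      (∀ v ∈ l, 1 ≤ ν' v ∧ ν' v ≤ M v.1) → Sat I ν' φ := by
  have hdual : ∀ (l : List (Var n)) ν, Sat I ν (alls l φ) ↔ ¬ Sat I ν (exs l (neg φ)) := by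
    intro l
    induction l with
    | nil => intro ν; simp [alls, exs, Sat]
    | cons i l ih =>
      intro ν
      have h₁ : Sat I ν (alls (i :: l) φ) ↔
          ∀ a, 1 ≤ a → a ≤ M i.1 → Sat I (Function.update ν i a) (alls l φ) := Iff.rfl
      have h₂ : Sat I ν (exs (i :: l) (neg φ)) ↔
          ∃ a, 1 ≤ a ∧ a ≤ M i.1 ∧ Sat I (Function.update ν i a) (exs l (neg φ)) := Iff.rfl
      rw [h₁, h₂]
      simp only [ih]
      push Not
      rfl
  rw [hdual, sat_exs]
  simp only [Sat]
  push Not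
  rfl

theorem freeVars_alls_subset (l : List (Var n)) (φ : MIL Pred) :
    freeVars (alls l φ) ⊆ freeVars φ \ {v | v ∈ l} := by
  induction l with
  | nil => simp [alls]
  | cons i l ih =>
    rintro v ⟨hv, hvi⟩
    have := ih hv
    exact ⟨this.1, fun h => (List.mem_cons.1 h).elim hvi this.2⟩

theorem sat_bigOr_ofFn (I : Interp Pred M) (ν : Var n → ℕ) {m : ℕ} (f : Fin m → MIL Pred) :
    Sat I ν (bigOr (List.ofFn f)) ↔ ∃ j, Sat I ν (f j) := by
  rw [List.ofFn_eq_map, sat_bigOr_map]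
  simp

theorem sat_bigAnd_ofFn (I : Interp Pred M) (ν : Var n → ℕ) {m : ℕ} (f : Fin m → MIL Pred) :
    Sat I ν (bigAnd (List.ofFn f)) ↔ ∀ j, Sat I ν (f j) := by
  rw [List.ofFn_eq_map, sat_bigAnd_map]
  simp

theorem exists_isMinModel_le [∀ k, Finite (Pred k)] {φ : MIL Pred} {I : Interp Pred M}
    (h : IsModel I φ) : ∃ J ≤ I, IsMinModel J φ :=
  (Set.toFinite {J : Interp Pred M | IsModel J φ}).exists_le_minimal h

end MIL

/-! ### Pre-states and post-states of ports -/

namespace Component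

variable {C : Component} {p : C.Port} {s s' : C.State}

theorem pre_eq_some (h : C.trans s p s') : C.pre p = some s := by
  have hex : ∃ s s', C.trans s p s' := ⟨s, s', h⟩
  obtain ⟨t, ht⟩ := hex.choose_spec
  rw [pre, dif_pos hex, (C.trans_unique h ht).1]

theorem exists_trans_of_post (h : C.post p = some s') : ∃ s, C.trans s p s' := by
  rw [post] at h
  split_ifs at h with hex
  obtain rfl := Option.some.inj h
  exact hex.choose_spec

end Component

/-- Truth of an equality or a disequality. -/
def EqLit.Holds {V : Type} (x : V → ℕ) : EqLit V → Prop
  | .eq i j => x i = x j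
  | .ne i j => x i ≠ x j

namespace Interaction

open MIL

variable {n : ℕ} {C : Fin n → Component} (γ : Interaction C) {M : Fin n → ℕ}

/-! ### Semantics of interactions -/

/-- The values `x` of the variables `i₁, …, iₗ` are in range and satisfy the guard. -/
def Admissible (M : Fin n → ℕ) (x : Fin γ.rdv → ℕ) : Prop :=
  (∀ j, 1 ≤ x j ∧ x j ≤ M (γ.type j)) ∧ ∀ l ∈ γ.guard, l.Holds x

/-- The pairs of a port and an instance that take part in the interaction, for the values `x` of the
variables `i₁, …, iₗ`. -/
inductive Fires (M : Fin n → ℕ) (x : Fin γ.rdv → ℕ) : ∀ k : Fin n, (C k).Port → ℕ → Prop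
  | rdv (j : Fin γ.rdv) : Fires M x (γ.type j) (γ.port j) (x j)
  | bcast (j : Fin γ.bcast) (a : ℕ) (h₁ : 1 ≤ a) (h₂ : a ≤ M (γ.btype j))
      (h : ∀ l ∈ γ.bguard j, l.Holds fun o => o.elim a x) :
      Fires M x (γ.btype j) (γ.bport j) a

/-- The state `s`, if there is one, contains the instance `a`. -/
def InState (I : Interp (fun k => (C k).Sym) M) (k : Fin n) (s : Option (C k).State) (a : ℕ) :
    Prop := ∃ s', s = some s' ∧ ∃ u ∈ I k (Sum.inr s'), u.1 = a

variable {γ} in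
theorem Fires.mem_range {x : Fin γ.rdv → ℕ} (hx : γ.Admissible M x) {k : Fin n} {p : (C k).Port}
    {a : ℕ} (h : γ.Fires M x k p a) : 1 ≤ a ∧ a ≤ M k := by
  cases h with
  | rdv j => exact hx.1 j
  | bcast j a h₁ h₂ h => exact ⟨h₁, h₂⟩

theorem forall_fires {x : Fin γ.rdv → ℕ} {P : ∀ k : Fin n, (C k).Port → ℕ → Prop} :
    (∀ k p a, γ.Fires M x k p a → P k p a) ↔
      (∀ j, P _ (γ.port j) (x j)) ∧ ∀ j a, 1 ≤ a → a ≤ M (γ.btype j) →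
        (∀ l ∈ γ.bguard j, l.Holds fun o => o.elim a x) → P _ (γ.bport j) a := by
  constructor
  · exact fun h => ⟨fun j => h _ _ _ (.rdv j), fun j a h₁ h₂ h₃ => h _ _ _ (.bcast j a h₁ h₂ h₃)⟩
  · rintro ⟨h₁, h₂⟩ k p a h
    cases h with
    | rdv j => exact h₁ j
    | bcast j a h₃ h₄ h => exact h₂ j a h₃ h₄ h

theorem exists_fires {x : Fin γ.rdv → ℕ} {P : ∀ k : Fin n, (C k).Port → ℕ → Prop} :
    (∃ k p a, γ.Fires M x k p a ∧ P k p a) ↔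
      (∃ j, P _ (γ.port j) (x j)) ∨ ∃ j a, 1 ≤ a ∧ a ≤ M (γ.btype j) ∧
        (∀ l ∈ γ.bguard j, l.Holds fun o => o.elim a x) ∧ P _ (γ.bport j) a := by
  have h := not_congr (γ.forall_fires (M := M) (x := x) (P := fun k p a => ¬ P k p a))
  rw [not_and_or] at h
  push Not at h
  exact h

theorem sat_litFormula {V : Type} (I : Interp (fun k => (C k).Sym) M) (ν : Var n → ℕ)
    (f : V → Var n) (l : EqLit V) : Sat I ν (litFormula f l) ↔ l.Holds fun v => ν (f v) := by
  cases l <;> rfl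

theorem sat_guardFormula (I : Interp (fun k => (C k).Sym) M) (ν : Var n → ℕ) :
    Sat I ν γ.guardFormula ↔ ∀ l ∈ γ.guard, l.Holds fun j => ν (γ.var j) := by
  simp only [guardFormula, sat_bigAnd_map, sat_litFormula]

theorem var_ne_bvar (i : Fin γ.rdv) (j : Fin γ.bcast) : γ.var i ≠ γ.bvar j := by
  intro h
  have h₁ : (i : ℕ) = γ.rdv + j := congrArg Prod.snd h
  omega

theorem var_injective : Function.Injective γ.var := fun i j h =>
  Fin.ext (show (i : ℕ) = j from congrArg Prod.snd h)

theorem sat_bguardFormula (I : Interp (fun k => (C k).Sym) M) (ν : Var n → ℕ) (j : Fin γ.bcast)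
    (a : ℕ) : Sat I (Function.update ν (γ.bvar j) a) (γ.bguardFormula j) ↔
      ∀ l ∈ γ.bguard j, l.Holds fun o => o.elim a fun i => ν (γ.var i) := by
  simp only [bguardFormula, sat_bigAnd_map, sat_litFormula]
  have : (fun o : Option (Fin γ.rdv) =>
      Function.update ν (γ.bvar j) a (o.elim (γ.bvar j) γ.var)) =
      fun o => o.elim a fun i => ν (γ.var i) := by
    funext o
    cases o with
    | none => simp
    | some i => simp [γ.var_ne_bvar i j]
  rw [this]

theorem sat_stateAtom (I : Interp (fun k => (C k).Sym) M) (ν : Var n → ℕ) {k : Fin n}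
    (s : Option (C k).State) (m : ℕ) :
    Sat I ν (stateAtom s m) ↔ InState I k s (ν (k, m)) := by
  cases s with
  | none => simp [stateAtom, InState, Sat]
  | some s =>
    simp only [stateAtom, InState, Option.elim_some, Sat, Option.some.injEq, exists_eq_left']

theorem exists_valuation (ν : Var n → ℕ) (x : Fin γ.rdv → ℕ) :
    ∃ ν' : Var n → ℕ, (∀ v, v ∉ γ.vars → ν' v = ν v) ∧ ∀ j, ν' (γ.var j) = x j := by
  refine ⟨Function.extend γ.var x ν, fun v hv => Function.extend_apply' _ _ _ ?_,
    fun j => γ.var_injective.extend_apply _ _ _⟩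
  simpa [vars, List.mem_ofFn] using hv

theorem forall_mem_vars {P : Var n → Prop} : (∀ v ∈ γ.vars, P v) ↔ ∀ j, P (γ.var j) := by
  rw [vars, List.forall_mem_ofFn_iff]

theorem sat_formula (I : Interp (fun k => (C k).Sym) M) (ν : Var n → ℕ) :
    Sat I ν γ.formula ↔ ∃ x, γ.Admissible M x ∧
      ∀ k p a, γ.Fires M x k p a → ∃ u ∈ I k (Sum.inl p), u.1 = a := by
  have key : ∀ ν : Var n → ℕ, Sat I ν (.and γ.guardFormula <| .and
      (.bigAnd (List.ofFn fun j => portAtom (γ.port j) (γ.var j).2))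
      (.bigAnd (List.ofFn fun j => .all (γ.bvar j)
        (.imp (γ.bguardFormula j) (portAtom (γ.bport j) (γ.bvar j).2))))) ↔
      (∀ l ∈ γ.guard, l.Holds fun j => ν (γ.var j)) ∧
      ∀ k p a, γ.Fires M (fun j => ν (γ.var j)) k p a → ∃ u ∈ I k (Sum.inl p), u.1 = a := by
    intro ν
    rw [γ.forall_fires]
    simp only [Sat, sat_guardFormula, sat_bigAnd_ofFn, sat_imp, sat_bguardFormula]
    refine and_congr_right fun _ => and_congr Iff.rfl ?_
    refine forall₂_congr fun j a => forall₃_congr fun _ _ _ => ?_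
    simp only [portAtom, Sat, bvar, Function.update_self]
  rw [formula, sat_exs]
  simp only [key, γ.forall_mem_vars]
  constructor
  · rintro ⟨ν', -, h₁, h₂, h₃⟩
    exact ⟨_, ⟨h₁, h₂⟩, h₃⟩
  · rintro ⟨x, ⟨h₁, h₂⟩, h₃⟩
    obtain ⟨ν', e, hν'⟩ := γ.exists_valuation ν x
    obtain rfl : (fun j => ν' (γ.var j)) = x := funext hν'
    exact ⟨ν', e, h₁, h₂, h₃⟩

theorem sat_somePre (I : Interp (fun k => (C k).Sym) M) (ν : Var n → ℕ) :
    Sat I ν γ.somePre ↔ ∃ k p a, γ.Fires M (fun j => ν (γ.var j)) k p a ∧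
      InState I k ((C k).pre p) a := by
  rw [γ.exists_fires]
  simp only [somePre, Sat, sat_bigOr_ofFn, sat_bguardFormula, sat_stateAtom]
  refine or_congr Iff.rfl (exists₂_congr fun j a => ?_)
  simp only [bvar, Function.update_self]

theorem sat_somePost (I : Interp (fun k => (C k).Sym) M) (ν : Var n → ℕ) :
    Sat I ν γ.somePost ↔ ∃ k p a, γ.Fires M (fun j => ν (γ.var j)) k p a ∧
      InState I k ((C k).post p) a := by
  rw [γ.exists_fires]
  simp only [somePost, Sat, sat_bigOr_ofFn, sat_bguardFormula, sat_stateAtom]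
  refine or_congr Iff.rfl (exists₂_congr fun j a => ?_)
  simp only [bvar, Function.update_self]

theorem sat_alls_vars (I : Interp (fun k => (C k).Sym) M) (ν : Var n → ℕ) (φ : Formula C)
    {P : (Fin γ.rdv → ℕ) → Prop} (h : ∀ ν, Sat I ν φ ↔ P fun j => ν (γ.var j)) :
    Sat I ν (.alls γ.vars φ) ↔ ∀ x, (∀ j, 1 ≤ x j ∧ x j ≤ M (γ.type j)) → P x := by
  rw [sat_alls]
  simp only [h, γ.forall_mem_vars]
  constructor
  · intro hs x hx
    obtain ⟨ν', e, hν'⟩ := γ.exists_valuation ν x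
    obtain rfl : (fun j => ν' (γ.var j)) = x := funext hν'
    exact hs ν' e hx
  · exact fun hs ν' _ hν' => hs _ hν'

/-- For each choice of values this is the trap condition on one set of firing ports: whatever takes
from the trap also gives to it. -/
theorem sat_trapConstraint (I : Interp (fun k => (C k).Sym) M) (ν : Var n → ℕ) :
    Sat I ν γ.trapConstraint ↔ ∀ x, γ.Admissible M x →
      (∃ k p a, γ.Fires M x k p a ∧ InState I k ((C k).pre p) a) →
      ∃ k p a, γ.Fires M x k p a ∧ InState I k ((C k).post p) a := by
  rw [trapConstraint, γ.sat_alls_vars I ν _ (P := fun x => (∀ l ∈ γ.guard, l.Holds x) ∧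
      (∃ k p a, γ.Fires M x k p a ∧ InState I k ((C k).pre p) a) →
      ∃ k p a, γ.Fires M x k p a ∧ InState I k ((C k).post p) a)]
  · exact forall_congr' fun x =>
      ⟨fun h hx hp => h hx.1 ⟨hx.2, hp⟩, fun h h₁ h₂ => h ⟨h₁, h₂.1⟩ h₂.2⟩
  · intro ν
    simp only [sat_imp, Sat, sat_guardFormula, sat_somePre, sat_somePost]

theorem sat_deadConstraint (I : Interp (fun k => (C k).Sym) M) (ν : Var n → ℕ) :
    Sat I ν γ.deadConstraint ↔ ∀ x, γ.Admissible M x →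
      ∃ k p a, γ.Fires M x k p a ∧ ¬ InState I k ((C k).pre p) a := by
  rw [deadConstraint, γ.sat_alls_vars I ν _ (P := fun x => (∀ l ∈ γ.guard, l.Holds x) →
      ∃ k p a, γ.Fires M x k p a ∧ ¬ InState I k ((C k).pre p) a)]
  · exact forall_congr' fun x => ⟨fun h hx => h hx.1 hx.2, fun h h₁ h₂ => h ⟨h₁, h₂⟩⟩
  · intro ν
    rw [γ.exists_fires]
    simp only [sat_imp, Sat, sat_guardFormula, sat_bigOr_ofFn, sat_bguardFormula, sat_stateAtom]
    refine imp_congr_right fun _ => or_congr Iff.rfl (exists₂_congr fun j a => ?_)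
    simp only [bvar, Function.update_self]

/-! ### Free variables of the trap constraint -/

theorem freeVars_litFormula_subset {V : Type} {f : V → Var n} {s : Set (Var n)}
    (hf : ∀ v, f v ∈ s) (l : EqLit V) : freeVars (litFormula f l : Formula C) ⊆ s := by
  cases l <;> exact Set.insert_subset (hf _) (Set.singleton_subset_iff.2 (hf _))

theorem freeVars_stateAtom_subset {k : Fin n} (s : Option (C k).State) (m : ℕ) :
    freeVars (stateAtom s m : Formula C) ⊆ {(k, m)} := by
  cases s
  · exact Set.empty_subset _
  · exact Set.Subset.refl _

theorem var_mem_vars (j : Fin γ.rdv) : γ.var j ∈ γ.vars := by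
  simp [vars, List.mem_ofFn]

theorem freeVars_guardFormula : freeVars γ.guardFormula ⊆ {v | v ∈ γ.vars} :=
  freeVars_bigAnd_subset (List.forall_mem_map.2 fun _ _ =>
    freeVars_litFormula_subset γ.var_mem_vars _)

theorem freeVars_bguardFormula (j : Fin γ.bcast) :
    freeVars (γ.bguardFormula j) ⊆ insert (γ.bvar j) {v | v ∈ γ.vars} := by
  refine freeVars_bigAnd_subset (List.forall_mem_map.2 fun _ _ =>
    freeVars_litFormula_subset (fun o => ?_) _)
  cases o with
  | none => exact Set.mem_insert _ _
  | some i => exact Set.mem_insert_of_mem _ (γ.var_mem_vars i)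

theorem freeVars_someState (f : ∀ k, (C k).Port → Option (C k).State) :
    freeVars (.or (.bigOr (List.ofFn fun j => stateAtom (f _ (γ.port j)) (γ.var j).2))
      (.bigOr (List.ofFn fun j => .ex (γ.bvar j)
        (.and (γ.bguardFormula j) (stateAtom (f _ (γ.bport j)) (γ.bvar j).2)))) : Formula C) ⊆
      {v | v ∈ γ.vars} := by
  refine Set.union_subset (freeVars_bigOr_subset ?_) (freeVars_bigOr_subset ?_) <;>
    rw [List.forall_mem_ofFn_iff] <;> intro j
  · refine (freeVars_stateAtom_subset _ _).trans ?_
    rintro v rfl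
    exact γ.var_mem_vars j
  · rintro v ⟨hv | hv, hvj⟩
    · exact (γ.freeVars_bguardFormula j hv).resolve_left hvj
    · exact absurd (freeVars_stateAtom_subset _ _ hv) hvj

theorem freeVars_trapConstraint : freeVars γ.trapConstraint ⊆ ∅ := by
  rintro v hv
  obtain ⟨(hv | hv) | hv, hv'⟩ := freeVars_alls_subset _ _ hv
  · exact hv' (γ.freeVars_guardFormula hv)
  · exact hv' (γ.freeVars_someState (fun k => (C k).pre) hv)
  · exact hv' (γ.freeVars_someState (fun k => (C k).post) hv)

end Interaction

namespace ParametricSystem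

open MIL Interaction

variable {n : ℕ} (S : ParametricSystem n) {M : Fin n → ℕ}

theorem isSentence_trapConstraint_and_initFormula :
    IsSentence (.and S.trapConstraint S.initFormula) := by
  refine Set.subset_empty_iff.1 (Set.union_subset
    (freeVars_bigAnd_subset (List.forall_mem_map.2 fun γ _ => γ.freeVars_trapConstraint))
    (freeVars_bigOr_subset (List.forall_mem_map.2 fun k _ => ?_)))
  simp only [freeVars]
  exact fun v hv => hv.2 hv.1

/-! ### Traps and deadlocks -/

theorem isModel_Γ_iff (I : Interp S.Pred M) :
    IsModel I S.Γ ↔ ∃ γ ∈ S.interactions, ∃ x, γ.Admissible M x ∧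
      ∀ k p a, γ.Fires M x k p a → ∃ u ∈ I k (Sum.inl p), u.1 = a := by
  simp only [IsModel, Γ, sat_bigOr_map, sat_formula, forall_const]

/-- The structure generated by an interaction. -/
def generated {S : ParametricSystem n} (M : Fin n → ℕ) (γ : Interaction S.comp)
    (x : Fin γ.rdv → ℕ) : Interp S.Pred M :=
  fun k => Sum.elim (fun p => {u | γ.Fires M x k p u.1}) fun _ => ∅

theorem isModel_generated {γ : Interaction S.comp} (hγ : γ ∈ S.interactions) {x : Fin γ.rdv → ℕ}
    (hx : γ.Admissible M x) : IsModel (generated M γ x) S.Γ := by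
  refine (S.isModel_Γ_iff _).2 ⟨γ, hγ, x, hx, fun k p a h => ?_⟩
  obtain ⟨h₁, h₂⟩ := h.mem_range hx
  exact ⟨⟨a, h₁, k, h₂⟩, h, rfl⟩

/-- A minimal model of the interaction formula is generated by one of the interactions. -/
theorem exists_fires_iff_of_isMinModel {I : Interp S.Pred M} (h : IsMinModel I S.Γ) :
    ∃ γ ∈ S.interactions, ∃ x, γ.Admissible M x ∧
      ∀ k p a, γ.Fires M x k p a ↔ ∃ u ∈ I k (Sum.inl p), u.1 = a := by
  obtain ⟨γ, hγ, x, hx, hI⟩ := (S.isModel_Γ_iff I).1 h.1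
  have hle : generated M γ x ≤ I := by
    rintro k (p | s) u hu
    · obtain ⟨w, hw, e⟩ := hI k p u.1 hu
      exact Univ.val_injective e ▸ hw
    · exact hu.elim
  -- The generated structure is itself a model of `Γ` below `I`, so minimality makes them equal.
  -- Hence no ports fire in `I` beyond those of the interaction.
  have hge := h.2 (S.isModel_generated hγ hx) hle
  refine ⟨γ, hγ, x, hx, fun k p a => ⟨hI k p a, ?_⟩⟩
  rintro ⟨u, hu, rfl⟩
  exact hge k (Sum.inl p) hu

/-- A model of the trap constraint is marked at a place of the Petri net. -/
def TrapMarked (J : Interp S.Pred M) (m : (S.petriNet M).Place → ℕ) : Prop :=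
  ∃ (k : Fin n) (s : (S.comp k).State) (i : {i : ℕ // 1 ≤ i ∧ i ≤ M k}),
    (∃ u ∈ J k (Sum.inr s), u.1 = i.1) ∧ 1 ≤ m ⟨k, s, i⟩

/-- A marked place of the trap loses its token only as an input of the fired transition. In that
case the trap constraint supplies an output place in the trap, which receives a token. -/
theorem TrapMarked.step {S : ParametricSystem n} {J : Interp S.Pred M}
    (hJ : IsModel J S.trapConstraint) {m m' : (S.petriNet M).Place → ℕ}
    (hm : S.TrapMarked J m) (h : (S.petriNet M).Step m m') : S.TrapMarked J m' := by
  obtain ⟨k, s, i, hi, hmi⟩ := hm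
  obtain ⟨t, -, ht⟩ := h
  have hpost : ∀ q, (S.petriNet M).output t q → 1 ≤ m' q := fun q hq => by
    rw [ht, if_pos hq]
    exact Nat.le_add_left _ _
  have hkeep : ∀ q, ¬ (S.petriNet M).input q t → m q ≤ m' q := fun q hq => by
    rw [ht, if_neg hq]
    exact Nat.le_add_right _ _
  by_cases hin : (S.petriNet M).input ⟨k, s, i⟩ t
  · obtain ⟨p, s', htr, hu⟩ := hin
    obtain ⟨γ, hγ, x, hx, hfires⟩ := S.exists_fires_iff_of_isMinModel t.2
    have hsat := hJ 0
    rw [trapConstraint, sat_bigAnd_map] at hsat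
    obtain ⟨k₁, p₁, a, hf, s₁, hs₁, hus⟩ := (γ.sat_trapConstraint J 0).1 (hsat γ hγ) x hx
      ⟨k, p, i.1, (hfires _ _ _).2 hu, s, Component.pre_eq_some htr, hi⟩
    obtain ⟨s₂, htr'⟩ := Component.exists_trans_of_post hs₁
    exact ⟨k₁, s₁, ⟨a, hf.mem_range hx⟩, hus, hpost _ ⟨p₁, s₂, htr', (hfires _ _ _).1 hf⟩⟩
  · exact ⟨k, s, i, hi, hmi.trans (hkeep _ hin)⟩

theorem TrapMarked.of_reachable {S : ParametricSystem n} {J : Interp S.Pred M}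
    (hJ : IsModel J (.and S.trapConstraint S.initFormula)) {m : (S.petriNet M).Place → ℕ}
    (hm : (S.petriNet M).Reachable m) : S.TrapMarked J m := by
  induction hm with
  | refl =>
    have hinit := (hJ 0).2
    rw [initFormula, sat_bigOr_map] at hinit
    obtain ⟨k, -, a, h₁, h₂, u, hu, e⟩ := hinit
    rw [Function.update_self] at e
    refine ⟨k, (S.comp k).initial, ⟨a, h₁, h₂⟩, ⟨u, hu, e⟩, ?_⟩
    simp [petriNet]
  | tail _ hstep ih => exact ih.step (fun ν => (hJ ν).1) hstep

/-- The structure given by a marking; ports are not interpreted. -/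
def ofMarking {S : ParametricSystem n} (m : (S.petriNet M).Place → ℕ) : Interp S.Pred M :=
  fun k => Sum.elim (fun _ => ∅) fun s =>
    {u | ∃ h : 1 ≤ u.1 ∧ u.1 ≤ M k, 1 ≤ m ⟨k, s, ⟨u.1, h⟩⟩}

/-- Deadlocks satisfy the deadlock constraint. -/
theorem isModel_deadConstraint {m : (S.petriNet M).Place → ℕ}
    (hm : (S.petriNet M).IsDeadlock m) : IsModel (ofMarking m) S.deadConstraint := by
  intro ν
  rw [deadConstraint, sat_bigAnd_map]
  intro γ hγ
  rw [sat_deadConstraint]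
  intro x hx
  by_contra hcon
  push Not at hcon
  -- The generated structure need not be minimal, as another choice may yield a smaller model. A
  -- minimal model below it only uses ports that fire in it, whose pre-states are all marked, so it
  -- is an enabled transition.
  obtain ⟨I, hI, hmin⟩ := exists_isMinModel_le (S.isModel_generated hγ hx)
  refine hm ⟨I, hmin⟩ ?_
  rintro ⟨k, s, i⟩ ⟨p, s', htr, u, hu, hui⟩
  obtain ⟨s₁, hs₁, w, ⟨hw, hmw⟩, e⟩ := hcon k p u.1 (hI k (Sum.inl p) hu)
  rw [Component.pre_eq_some htr] at hs₁
  obtain rfl := Option.some.inj hs₁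
  have : (⟨w.1, hw⟩ : {i : ℕ // 1 ≤ i ∧ i ≤ M k}) = i := Subtype.ext (e.trans hui)
  rwa [this] at hmw

theorem deadlockFree_of_not_satisfiableAt {χ : MIL S.Pred}
    (hχ : IsPositivation (.and S.trapConstraint S.initFormula) χ)
    (h : ¬ SatisfiableAt M (.and (dual χ) S.deadConstraint)) : (S.petriNet M).DeadlockFree := by
  intro m hreach hdead
  refine h ⟨ofMarking m, fun ν => ⟨?_, S.isModel_deadConstraint hdead ν⟩⟩
  rw [sat_dual _ _ (by rw [show freeVars χ = ∅ from hχ.1]; simp)]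
  intro hsat
  -- Passing to a minimal model lets the minimal equivalence turn a model of `χ` into a trap. Lying
  -- below the complement of the marking, this trap contains no marked place, whereas reachability
  -- provides one.
  obtain ⟨J, hJ, hmin⟩ := exists_isMinModel_le ((hχ.1.isModel_iff _ ν).2 hsat)
  obtain ⟨k, s, i, ⟨u, hu, e⟩, hmi⟩ := TrapMarked.of_reachable ((hχ.2.2 M J).2 hmin).1 hreach
  refine hJ k (Sum.inr s) hu ⟨by rw [e]; exact i.2, ?_⟩
  have : (⟨u.1, by rw [e]; exact i.2⟩ : {i : ℕ // 1 ≤ i ∧ i ≤ M k}) = i := Subtype.ext e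
  rwa [this]

end ParametricSystem

theorem mainTheorem3 {n : ℕ} (S : ParametricSystem n) :
    (∀ φ : MIL S.Pred, φ.IsSentence → MIL.IsPositivation φ (MIL.ppos φ)) ∧
    (∀ M : Fin n → ℕ,
      ¬ MIL.SatisfiableAt M
        (.and (MIL.dual (MIL.ppos (.and S.trapConstraint S.initFormula))) S.deadConstraint) →
      (S.petriNet M).DeadlockFree) ∧
    (∀ χ : MIL S.Pred, MIL.IsPositivation (.and S.trapConstraint S.initFormula) χ →
      ∀ M : Fin n → ℕ,
        ¬ MIL.SatisfiableAt M (.and (MIL.dual χ) S.deadConstraint) →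
        (S.petriNet M).DeadlockFree) := by
  have hppos := S.isSentence_trapConstraint_and_initFormula.isPositivation_ppos
  exact ⟨fun φ hφ => hφ.isPositivation_ppos,
    fun M h => S.deadlockFree_of_not_satisfiableAt hppos h,
    fun χ hχ M h => S.deadlockFree_of_not_satisfiableAt hχ h⟩
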